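/- Theorem 3. Let $m\ge 1$ be an integer, $\gamma_1,\gamma_2,K>0$. For every prime $p$ let $c_1(p),\dots,c_m(p)\in\mathbb{C}$ with $|c_j(p)|\le 1$, and put $L(s)=\prod_p\prod_{j=1}^m(1-c_j(p)p^{-s})^{-1}$ for $\Re s>1$ (throughout, $p$ runs over primes). Let $N\ge 16$ be an integer, $1/2\le\sigma_L<1$ and $0<\delta<7(1-\sigma_L)$ (so $\delta<7/2$). Assume: (1) $L$ continues to a holomorphic function on $\Re s\ge\sigma_L$; (2) $L$ has no zero in $D_{\delta,N}=\{\Re s\ge 1\}\cup\{1-\delta/7\le\Re s<1,\ |\Im s|\le 2(\log N)^3\}$; (3) $|L(\sigma+it)|\le K N^{\gamma_1}(1+|t|)^{\gamma_2}$ for $\sigma_L<\sigma<4$ and $t\in\mathbb{R}$. Let $\log L$ be the holomorphic logarithm of $L$ on $D_{\delta,N}$ that equals $-\sum_p\sum_{j=1}^m\log(1-c_j(p)p^{-s})$ (principal logarithms) for $\Re s>1$; such a logarithm exists and is unique on $D_{\delta,N}$. Put $d_p(\ell)=\sum_{j=1}^m c_j(p)^\ell$ and, for $\alpha>1/2$,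 $C(\alpha)=\sum_p\sum_{\ell\ge 2}\frac{d_p(\ell)}{\ell p^{\ell\alpha}}$. Then for all real $\alpha$ and $y$ with $1-\delta/28<\alpha<2-\delta/7$ and $(\log N)^{14/\delta}\le y\le N^{2\pi/5}$, $$\log L(\alpha)=\sum_{p\le y}\frac{d_p(1)}{p^\alpha}+C(\alpha)+O\left(\frac{y^{1-\alpha}}{(2-\alpha)^2\log y}+\frac{(\log N)^2}{(\log\log N)(\log N)^{14/\delta}}+\frac{y^{1+\delta/14}(\log N)^{\delta/14+3/2}}{\delta^2N^{\pi/2}}+\frac{y^{1-\delta/14-\alpha}\log N}{\delta^3\log y}\right),$$ where the implied constant depends only on $m,\gamma_1,\gamma_2,K$. In particular, with an implied constant depending only on the same quantities, $$\log L(1)=\sum_{p\le y}\frac{d_p(1)}{p}+C(1)+O\left(\frac{1}{\log y}+\frac{(\log N)^2}{(\log\log N)(\log N)^{14/\delta}}+\frac{y^{1+\delta/14}(\log N)^{\delta/14+3/2}}{\delta^2N^{\pi/2}}+\frac{\log N}{\delta^3y^{\delta/14}\log y}\right).$$ For each fixed $\delta\in(0,7/2)$ the expression inside the last $O(\cdot)$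 is $o(1)$ as $N\to\infty$, uniformly for $(\log N)^{14/\delta}\le y\le N^{2\pi/5}$. -/

import Mathlib

open Complex

/-- `d_p(ℓ) = ∑_{j=1}^m c_j(p)^ℓ`. -/
def dCoeff {m : ℕ} (c : ℕ → Fin m → ℂ) (p ℓ : ℕ) : ℂ :=
  ∑ j : Fin m, c p j ^ ℓ

/-- `L(s) = ∏_p ∏_{j=1}^m (1 - c_j(p) p^{-s})⁻¹` for `Re s > 1`, where `|c_j(p)| ≤ 1` for all
primes `p`. (`L` is a function on `ℂ`; to the left of `Re s = 1` it is constrained separately.) -/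
def HasEulerProduct {m : ℕ} (c : ℕ → Fin m → ℂ) (L : ℂ → ℂ) : Prop :=
  (∀ p : ℕ, p.Prime → ∀ j : Fin m, ‖c p j‖ ≤ 1) ∧
    ∀ s : ℂ, 1 < s.re →
      HasProd (fun p : Nat.Primes =>
        ∏ j : Fin m, (1 - c (p : ℕ) j * ((p : ℕ) : ℂ) ^ (-s))⁻¹) (L s)

/-- The region `D_{δ,N}`: the closed half plane `σ ≥ 1` together with the rectangle
`1 - δ/7 ≤ σ < 1`, `|t| ≤ 2 (log N)^3`. -/
def zeroFreeRegion (δ : ℝ) (N : ℕ) : Set ℂ :=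
  {s : ℂ | 1 ≤ s.re} ∪
    {s : ℂ | 1 - δ / 7 ≤ s.re ∧ s.re < 1 ∧ |s.im| ≤ 2 * (Real.log N) ^ 3}

/-- `logL` is the logarithm of `L` on `D_{δ,N}`: it is holomorphic there, it is a logarithm of `L`,
and for `σ > 1` it is given by the Euler product,
`log L(s) = -∑_p ∑_j log (1 - c_j(p) p^{-s})` (principal logarithms; `|c_j(p) p^{-s}| < 1/2`).
As `D_{δ,N}` is connected, this determines `logL` on `D_{δ,N}`. -/
structure IsLogOfL {m : ℕ} (c : ℕ → Fin m → ℂ) (L : ℂ → ℂ) (δ : ℝ) (N : ℕ)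
    (logL : ℂ → ℂ) : Prop where
  holomorphic : AnalyticOnNhd ℂ logL (zeroFreeRegion δ N)
  exp_eq : ∀ s ∈ zeroFreeRegion δ N, Complex.exp (logL s) = L s
  eulerSeries : ∀ s : ℂ, 1 < s.re →
    HasSum (fun p : Nat.Primes =>
      ∑ j : Fin m, -Complex.log (1 - c (p : ℕ) j * ((p : ℕ) : ℂ) ^ (-s))) (logL s)

/-- `∑_{p ≤ y} d_p(1) / p^α`. -/
noncomputable def primeSum {m : ℕ} (c : ℕ → Fin m → ℂ) (y α : ℝ) : ℂ :=
  ∑ p ∈ (Finset.range (⌊y⌋₊ + 1)).filter Nat.Prime, dCoeff c p 1 / (p : ℂ) ^ (α : ℂ)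

/-- `C(α) = ∑_p ∑_{ℓ ≥ 2} d_p(ℓ) / (ℓ p^{ℓα})`; the index `k` stands for `ℓ - 2`. The series
converges absolutely for `α > 1/2`, whenever `|c_j(p)| ≤ 1`. -/
noncomputable def CConst {m : ℕ} (c : ℕ → Fin m → ℂ) (α : ℝ) : ℂ :=
  ∑' p : Nat.Primes, ∑' k : ℕ,
    dCoeff c (p : ℕ) (k + 2) /
      (((k + 2 : ℕ) : ℂ) * ((p : ℕ) : ℂ) ^ (((k + 2 : ℕ) : ℂ) * (α : ℂ)))

/-- The error term of the asymptotic formula for `log L(α)`. -/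
noncomputable def errorTerm (δ : ℝ) (N : ℕ) (y α : ℝ) : ℝ :=
  y ^ (1 - α) / ((2 - α) ^ 2 * Real.log y)
    + (Real.log N) ^ 2 / (Real.log (Real.log N) * (Real.log N) ^ (14 / δ))
    + y ^ (1 + δ / 14) * (Real.log N) ^ (δ / 14 + 3 / 2)
        / (δ ^ 2 * (N : ℝ) ^ (Real.pi / 2))
    + y ^ (1 - δ / 14 - α) * Real.log N / (δ ^ 3 * Real.log y)

/-- The error term of the asymptotic formula for `log L(1)`. -/
noncomputable def errorTermOne (δ : ℝ) (N : ℕ) (y : ℝ) : ℝ :=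
  1 / Real.log y
    + (Real.log N) ^ 2 / (Real.log (Real.log N) * (Real.log N) ^ (14 / δ))
    + y ^ (1 + δ / 14) * (Real.log N) ^ (δ / 14 + 3 / 2)
        / (δ ^ 2 * (N : ℝ) ^ (Real.pi / 2))
    + Real.log N / (δ ^ 3 * y ^ (δ / 14) * Real.log y)

/-!
The proof is a finite contour argument in the style of Newman, so neither an inverse Mellin
transform nor a prime number estimate is needed. Write `l = log N`, `H = l²`, `Y = ⌊y⌋`, and let
`P(s) = log L(s) - C(s)`, which for `Re s > 1` is `∑_p d_p(1) p^{-s}`, and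
`S(s) = ∑_{p ≤ Y} d_p(1) p^{-s}`, so that `P(α) - S(α)` is the quantity to be bounded. The kernel
`Y^{s-α} (1 + ((s-1)/H)²) / (s-α)` has a simple pole at `α`, with residue at least `1`. Integrate
`P` against it around `[1 - δ/8, 1 + H] × [-H, H]` and the entire function `S` around
`[1 - H, 1 + H] × [-H, H]`, and subtract (`rectIntegral_div_sub`, `norm_sub_le_of_contour`).

* On the part to the right of `Re s = 1` only `P - S` occurs, of size
  `O(Y^{1 - Re s} / (Re s - 1))`; to the left, `S` is `O(Y^{1 - Re s} / (1 - Re s))`.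
  These are trivial estimates over all integers
  (`norm_sub_primePartialSum_le`, `norm_primePartialSum_le`). On the horizontal sides the factor
  `1 + ((s-1)/H)²` is `O(|Re s - 1| / H)` and cancels the singularity at `Re s = 1`. Together these
  sides give `O(y^{1-α} / H)`, which is below the first summand of the error term.
* On the rest of the contour for `P` the Borel–Carathéodory theorem turns the growth hypothesis
  for `L` into `P = O(l / δ)` (`exists_norm_logL_sub_le`). The left side at `Re s = 1 - δ/8` gives
  `O(y^{1-δ/8-α} (l / δ) log (1 + H / δ))`, and `y^δ ≥ l^{14}` makes this smaller than the last
  summand of the error term (`rpow_mul_log_le`).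

A logarithm of `L` exists because the zero-free region is star convex about `2`
(`exists_isLogOfL`).
-/

/-! ### The Euler product: its logarithm and the contribution of prime powers -/

/-- The Euler logarithm `-∑_p ∑_j log (1 - c_j(p) p^{-s})`. -/
noncomputable def eulerLog {m : ℕ} (c : ℕ → Fin m → ℂ) (s : ℂ) : ℂ :=
  ∑' p : Nat.Primes, ∑ j : Fin m, -Complex.log (1 - c (p : ℕ) j * ((p : ℕ) : ℂ) ^ (-s))

/-- `C(s)` for complex `s`: the part of the Euler logarithm coming from prime powers `p^ℓ` with
`ℓ ≥ 2`, summed over `ℓ` in closed form. -/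
noncomputable def primePowerSeries {m : ℕ} (c : ℕ → Fin m → ℂ) (s : ℂ) : ℂ :=
  ∑' p : Nat.Primes, ∑ j : Fin m,
    (-Complex.log (1 - c (p : ℕ) j * ((p : ℕ) : ℂ) ^ (-s)) - c (p : ℕ) j * ((p : ℕ) : ℂ) ^ (-s))

lemma prime_rpow_neg_le (p : Nat.Primes) {a b : ℝ} (h : a ≤ b) :
    ((p : ℕ) : ℝ) ^ (-b) ≤ ((p : ℕ) : ℝ) ^ (-a) :=
  Real.rpow_le_rpow_of_exponent_le (mod_cast p.2.one_lt.le) (by linarith)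

lemma prime_rpow_neg_le_half (p : Nat.Primes) {a : ℝ} (h : 1 ≤ a) :
    ((p : ℕ) : ℝ) ^ (-a) ≤ 1 / 2 := by
  refine (prime_rpow_neg_le p h).trans ?_
  rw [Real.rpow_neg_one, one_div]
  exact inv_anti₀ two_pos (mod_cast p.2.two_le)

lemma prime_rpow_neg_le_three_quarters (p : Nat.Primes) {a : ℝ} (h : 1 / 2 ≤ a) :
    ((p : ℕ) : ℝ) ^ (-a) ≤ 3 / 4 := by
  refine (prime_rpow_neg_le p h).trans ?_
  rw [Real.rpow_neg (by positivity), ← Real.sqrt_eq_rpow]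
  have h2 : (2 : ℝ) ≤ (p : ℕ) := mod_cast p.2.two_le
  rw [inv_le_comm₀ (by positivity) (by norm_num)]
  exact Real.le_sqrt_of_sq_le (by norm_num; linarith)

lemma norm_eulerRoot_le {m : ℕ} {c : ℕ → Fin m → ℂ}
    (hc : ∀ p : ℕ, p.Prime → ∀ j, ‖c p j‖ ≤ 1) (p : Nat.Primes) (j : Fin m) (s : ℂ) :
    ‖c (p : ℕ) j * ((p : ℕ) : ℂ) ^ (-s)‖ ≤ ((p : ℕ) : ℝ) ^ (-s.re) := by
  rw [norm_mul, Complex.norm_natCast_cpow_of_pos p.2.pos, Complex.neg_re]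
  exact mul_le_of_le_one_left (by positivity) (hc p p.2 j)

lemma norm_neg_log_one_sub_sub_le {x : ℂ} (hx : ‖x‖ ≤ 3 / 4) :
    ‖-Complex.log (1 - x) - x‖ ≤ 2 * ‖x‖ ^ 2 := by
  have h := Complex.norm_log_one_add_sub_self_le (z := -x) (by rw [norm_neg]; linarith)
  rw [norm_neg, ← sub_eq_add_neg, ← norm_neg] at h
  have h4 : (1 - ‖x‖)⁻¹ ≤ 4 := by
    rw [inv_le_comm₀ (by linarith) (by norm_num)]; norm_num; linarith
  calc ‖-Complex.log (1 - x) - x‖ = ‖-(Complex.log (1 - x) - -x)‖ := by congr 1; ring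
    _ ≤ ‖x‖ ^ 2 * (1 - ‖x‖)⁻¹ / 2 := h
    _ ≤ ‖x‖ ^ 2 * 4 / 2 := by gcongr
    _ = 2 * ‖x‖ ^ 2 := by ring

lemma norm_neg_log_one_sub_le {x : ℂ} (hx : ‖x‖ ≤ 1 / 2) :
    ‖-Complex.log (1 - x)‖ ≤ 3 / 2 * ‖x‖ := by
  have h := Complex.norm_log_one_add_half_le_self (z := -x) (by rwa [norm_neg])
  rwa [norm_neg, ← sub_eq_add_neg, ← norm_neg] at h

lemma summable_primePower_majorant (m : ℕ) {a : ℝ} (ha : 1 / 2 < a) :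
    Summable fun p : Nat.Primes => (m : ℝ) * (2 * ((p : ℕ) : ℝ) ^ (-(2 * a))) :=
  ((Nat.Primes.summable_rpow.mpr (by linarith)).mul_left _).mul_left _

lemma summable_eulerLog_majorant (m : ℕ) {a : ℝ} (ha : 1 < a) :
    Summable fun p : Nat.Primes => (m : ℝ) * (3 / 2 * ((p : ℕ) : ℝ) ^ (-a)) :=
  ((Nat.Primes.summable_rpow.mpr (by linarith)).mul_left _).mul_left _

lemma differentiableAt_eulerRoot {m : ℕ} (c : ℕ → Fin m → ℂ) (p : Nat.Primes) (j : Fin m) (s : ℂ) :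
    DifferentiableAt ℂ (fun s => c (p : ℕ) j * ((p : ℕ) : ℂ) ^ (-s)) s := by
  have : ((p : ℕ) : ℂ) ≠ 0 := mod_cast p.2.ne_zero
  exact (differentiableAt_id.neg.const_cpow (Or.inl this)).const_mul _

section

variable {m : ℕ} {c : ℕ → Fin m → ℂ} (hc : ∀ p : ℕ, p.Prime → ∀ j, ‖c p j‖ ≤ 1)
include hc

lemma norm_primePower_term_le (p : Nat.Primes) {a : ℝ} (ha : 1 / 2 ≤ a) {s : ℂ} (hs : a ≤ s.re) :
    ‖∑ j : Fin m, (-Complex.log (1 - c (p : ℕ) j * ((p : ℕ) : ℂ) ^ (-s))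
      - c (p : ℕ) j * ((p : ℕ) : ℂ) ^ (-s))‖ ≤ m * (2 * ((p : ℕ) : ℝ) ^ (-(2 * a))) := by
  refine (norm_sum_le_of_le (n := fun _ => 2 * ((p : ℕ) : ℝ) ^ (-(2 * a))) _ fun j _ => ?_).trans_eq
    (by simp)
  have h := (norm_eulerRoot_le hc p j s).trans (prime_rpow_neg_le p hs)
  refine (norm_neg_log_one_sub_sub_le (h.trans (prime_rpow_neg_le_three_quarters p ha))).trans ?_
  have : ((p : ℕ) : ℝ) ^ (-(2 * a)) = (((p : ℕ) : ℝ) ^ (-a)) ^ 2 := by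
    rw [← Real.rpow_mul_natCast (by positivity)]; congr 1; push_cast; ring
  rw [this]
  gcongr

lemma norm_eulerLog_term_le (p : Nat.Primes) {a : ℝ} (ha : 1 ≤ a) {s : ℂ} (hs : a ≤ s.re) :
    ‖∑ j : Fin m, -Complex.log (1 - c (p : ℕ) j * ((p : ℕ) : ℂ) ^ (-s))‖
      ≤ m * (3 / 2 * ((p : ℕ) : ℝ) ^ (-a)) := by
  refine (norm_sum_le_of_le (n := fun _ => 3 / 2 * ((p : ℕ) : ℝ) ^ (-a)) _ fun j _ => ?_).trans_eq
    (by simp)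
  have h := (norm_eulerRoot_le hc p j s).trans (prime_rpow_neg_le p hs)
  refine (norm_neg_log_one_sub_le (h.trans (prime_rpow_neg_le_half p ha))).trans ?_
  gcongr

lemma differentiableAt_log_one_sub_eulerRoot (p : Nat.Primes) (j : Fin m) {s : ℂ}
    (hs : 1 / 2 ≤ s.re) :
    DifferentiableAt ℂ (fun s => -Complex.log (1 - c (p : ℕ) j * ((p : ℕ) : ℂ) ^ (-s))) s := by
  have h := (norm_eulerRoot_le hc p j s).trans (prime_rpow_neg_le_three_quarters p hs)
  refine (((differentiableAt_eulerRoot c p j s).const_sub 1).clog ?_).neg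
  rw [sub_eq_add_neg]
  exact Complex.mem_slitPlane_of_norm_lt_one (by rw [norm_neg]; linarith)

lemma differentiableAt_primePowerSeries {s : ℂ} (hs : 1 / 2 < s.re) :
    DifferentiableAt ℂ (primePowerSeries c) s := by
  obtain ⟨a, ha, has⟩ := exists_between hs
  have ho : IsOpen {s : ℂ | a < s.re} := isOpen_lt continuous_const Complex.continuous_re
  refine (differentiableOn_tsum_of_summable_norm (U := {s : ℂ | a < s.re})
    (summable_primePower_majorant m ha) (fun p => ?_) ho
    fun p w hw => norm_primePower_term_le hc p ha.le (le_of_lt hw)).differentiableAt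
      (ho.mem_nhds has)
  refine DifferentiableOn.fun_sum fun j _ w hw => ?_
  exact ((differentiableAt_log_one_sub_eulerRoot hc p j (ha.le.trans (le_of_lt hw))).sub
    (differentiableAt_eulerRoot c p j w)).differentiableWithinAt

lemma differentiableAt_eulerLog {s : ℂ} (hs : 1 < s.re) :
    DifferentiableAt ℂ (eulerLog c) s := by
  obtain ⟨a, ha, has⟩ := exists_between hs
  have ho : IsOpen {s : ℂ | a < s.re} := isOpen_lt continuous_const Complex.continuous_re
  refine (differentiableOn_tsum_of_summable_norm (U := {s : ℂ | a < s.re})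
    (summable_eulerLog_majorant m ha) (fun p => ?_) ho
    fun p w hw => norm_eulerLog_term_le hc p ha.le (le_of_lt hw)).differentiableAt
      (ho.mem_nhds has)
  refine DifferentiableOn.fun_sum fun j _ w hw => ?_
  have hw' : a < w.re := hw
  exact (differentiableAt_log_one_sub_eulerRoot hc p j (by linarith)).differentiableWithinAt

lemma hasSum_eulerLog {s : ℂ} (hs : 1 < s.re) :
    HasSum (fun p : Nat.Primes =>
      ∑ j : Fin m, -Complex.log (1 - c (p : ℕ) j * ((p : ℕ) : ℂ) ^ (-s))) (eulerLog c s) :=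
  (Summable.of_norm_bounded (summable_eulerLog_majorant m hs)
    fun p => norm_eulerLog_term_le hc p hs.le le_rfl).hasSum

lemma hasSum_primePowerSeries {s : ℂ} (hs : 1 / 2 < s.re) :
    HasSum (fun p : Nat.Primes => ∑ j : Fin m,
      (-Complex.log (1 - c (p : ℕ) j * ((p : ℕ) : ℂ) ^ (-s)) - c (p : ℕ) j * ((p : ℕ) : ℂ) ^ (-s)))
      (primePowerSeries c s) :=
  (Summable.of_norm_bounded (summable_primePower_majorant m hs)
    fun p => norm_primePower_term_le hc p hs.le le_rfl).hasSum

lemma norm_eulerLog_le {a : ℝ} (ha : 1 < a) {s : ℂ} (hs : a ≤ s.re) :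
    ‖eulerLog c s‖ ≤ m * (3 / 2 * ∑' p : Nat.Primes, ((p : ℕ) : ℝ) ^ (-a)) := by
  rw [← tsum_mul_left, ← tsum_mul_left]
  exact tsum_of_norm_bounded (summable_eulerLog_majorant m ha).hasSum
    fun p => norm_eulerLog_term_le hc p ha.le hs

lemma norm_primePowerSeries_le {a : ℝ} (ha : 1 / 2 < a) {s : ℂ} (hs : a ≤ s.re) :
    ‖primePowerSeries c s‖ ≤ m * (2 * ∑' p : Nat.Primes, ((p : ℕ) : ℝ) ^ (-(2 * a))) := by
  rw [← tsum_mul_left, ← tsum_mul_left]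
  exact tsum_of_norm_bounded (summable_primePower_majorant m ha).hasSum
    fun p => norm_primePower_term_le hc p ha.le hs

/-- Removing `C(s)` from the Euler logarithm leaves the Dirichlet series over the primes. -/
lemma hasSum_primes_of_hasSum_eulerLog {s l : ℂ} (hs : 1 < s.re)
    (hl : HasSum (fun p : Nat.Primes =>
      ∑ j : Fin m, -Complex.log (1 - c (p : ℕ) j * ((p : ℕ) : ℂ) ^ (-s))) l) :
    HasSum (fun p : Nat.Primes => dCoeff c p 1 * ((p : ℕ) : ℂ) ^ (-s))
      (l - primePowerSeries c s) := by
  refine (hl.sub (hasSum_primePowerSeries hc (by linarith))).congr_fun fun p => ?_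
  simp only [dCoeff, pow_one, Finset.sum_mul, ← Finset.sum_sub_distrib, sub_sub_cancel]

lemma CConst_eq_primePowerSeries {α : ℝ} (hα : 1 / 2 < α) :
    CConst c α = primePowerSeries c α := by
  refine tsum_congr fun p => HasSum.tsum_eq ?_
  have hp : ((p : ℕ) : ℂ) ≠ 0 := mod_cast p.2.ne_zero
  have key : ∀ j : Fin m, HasSum (fun k : ℕ =>
      (c (p : ℕ) j * ((p : ℕ) : ℂ) ^ (-(α : ℂ))) ^ (k + 2) / ((k + 2 : ℕ) : ℂ))
      (-Complex.log (1 - c (p : ℕ) j * ((p : ℕ) : ℂ) ^ (-(α : ℂ)))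
        - c (p : ℕ) j * ((p : ℕ) : ℂ) ^ (-(α : ℂ))) := by
    intro j
    have h := (norm_eulerRoot_le hc p j α).trans
      (prime_rpow_neg_le_three_quarters p (by simpa using hα.le))
    have := (hasSum_nat_add_iff' 2).mpr (Complex.hasSum_taylorSeries_neg_log
      (h.trans_lt (by norm_num)))
    simpa [Finset.sum_range_succ] using this
  refine (hasSum_sum fun j _ => key j).congr_fun fun k => ?_
  rw [dCoeff, Finset.sum_div]
  refine Finset.sum_congr rfl fun j _ => ?_
  rw [mul_pow, ← Complex.cpow_nat_mul, mul_neg, Complex.cpow_neg]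
  have : ((p : ℕ) : ℂ) ^ (((k + 2 : ℕ) : ℂ) * (α : ℂ)) ≠ 0 := by simp [Complex.cpow_eq_zero_iff, hp]
  have h2 : ((k + 2 : ℕ) : ℂ) ≠ 0 := Nat.cast_ne_zero.mpr (by omega)
  field_simp

end

/-! ### The holomorphic logarithm on the zero-free region -/

/-- A continuous logarithm of an analytic function is analytic: near each point it differs by a
constant from the principal logarithm of a quotient close to `1`. -/
lemma analyticAt_of_exp_eventuallyEq {f g : ℂ → ℂ} {z : ℂ} (hf : AnalyticAt ℂ f z)
    (hg : ContinuousAt g z) (h : ∀ᶠ s in nhds z, Complex.exp (g s) = f s) : AnalyticAt ℂ g z := by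
  have hz : Complex.exp (g z) = f z := h.self_of_nhds
  have hfz : f z ≠ 0 := hz ▸ Complex.exp_ne_zero _
  have h1 : AnalyticAt ℂ (fun s => Complex.log (f s / f z) + g z) z := by
    refine ((hf.div analyticAt_const hfz).clog ?_).add analyticAt_const
    simp [hfz]
  refine h1.congr ?_
  have h2 : ∀ᶠ s in nhds z, ‖g s - g z‖ < Real.pi := by
    have : ContinuousAt (fun s => ‖g s - g z‖) z := by fun_prop
    exact this.eventually_lt_const (by simpa using Real.pi_pos)
  filter_upwards [h, h2] with s hs hs2
  have h3 := (Complex.abs_im_le_norm (g s - g z)).trans_lt hs2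
  rw [abs_lt] at h3
  rw [← hs, ← hz, ← Complex.exp_sub, Complex.log_exp h3.1 h3.2.le]
  ring

/-- A zero-free analytic function on a star convex set, which need not be open, has an analytic
logarithm there. -/
theorem exists_analyticOnNhd_log {f : ℂ → ℂ} {D : Set ℂ} {z₀ : ℂ} (hD : StarConvex ℝ z₀ D)
    (hne : D.Nonempty) (hf : AnalyticOnNhd ℂ f D) (h0 : ∀ s ∈ D, f s ≠ 0) :
    ∃ g : ℂ → ℂ, AnalyticOnNhd ℂ g D ∧ ∀ s ∈ D, Complex.exp (g s) = f s := by
  -- `U` is an open star convex neighbourhood of `D` on which `f` is still analytic and zero-free.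
  let W : Set ℂ := {s | AnalyticAt ℂ f s ∧ f s ≠ 0}
  let U : Set ℂ := {s | ∀ t ∈ Set.Icc (0 : ℝ) 1, z₀ + (t : ℂ) * (s - z₀) ∈ W}
  have hW : IsOpen W := by
    rw [isOpen_iff_eventually]
    intro s hs
    exact hs.1.eventually_analyticAt.and (hs.1.continuousAt.eventually_ne hs.2)
  have hUo : IsOpen U := by
    rw [isOpen_iff_eventually]
    intro s hs
    refine isCompact_Icc.eventually_forall_of_forall_eventually fun t ht => ?_
    have hcont : Continuous fun q : ℂ × ℝ => z₀ + (q.2 : ℂ) * (q.1 - z₀) := by fun_prop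
    exact hcont.continuousAt.eventually (hW.mem_nhds (hs t ht))
  have hDU : D ⊆ U := by
    intro s hs t ht
    have hmem : z₀ + (t : ℂ) * (s - z₀) ∈ D := by
      have := hD hs (a := 1 - t) (b := t) (by linarith [ht.2]) ht.1 (by ring)
      convert this using 1
      simp only [Complex.real_smul]; push_cast; ring
    exact ⟨hf _ hmem, h0 _ hmem⟩
  have hUW : U ⊆ W := fun s hs => by simpa using hs 1 (by simp)
  have hUs : StarConvex ℝ z₀ U := by
    intro s hs a b ha hb hab t ht
    have := hs (t * b) ⟨mul_nonneg ht.1 hb, by nlinarith [ht.1, ht.2]⟩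
    convert this using 1
    simp only [Complex.real_smul]
    have : (a : ℂ) = 1 - b := by rw [← Complex.ofReal_one, ← hab]; simp
    rw [this]; push_cast; ring
  have hsc : IsSimplyConnected U := by
    have := hUs.contractibleSpace (hne.mono hDU)
    exact SimplyConnectedSpace.ofContractible U
  obtain ⟨g, hgc, hg⟩ := Complex.exists_continuousOn_eqOn_exp_comp hsc hUo
    (fun s hs => (hUW hs).1.continuousAt.continuousWithinAt)
    (by rintro ⟨s, hs, hs0⟩; exact (hUW hs).2 hs0)
  refine ⟨g, fun s hs => ?_, fun s hs => hg (hDU hs)⟩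
  have hn := hUo.mem_nhds (hDU hs)
  exact analyticAt_of_exp_eventuallyEq (hf s hs) (hgc.continuousAt hn)
    (Filter.eventually_of_mem hn fun w hw => hg hw)

lemma starConvex_zeroFreeRegion {δ : ℝ} (hδ : 0 ≤ δ) (N : ℕ) :
    StarConvex ℝ (2 : ℂ) (zeroFreeRegion δ N) := by
  intro s hs a b ha hb hab
  have hre : (a • (2 : ℂ) + b • s).re = a * 2 + b * s.re := by simp
  have him : (a • (2 : ℂ) + b • s).im = b * s.im := by simp
  by_cases h : 1 ≤ (a • (2 : ℂ) + b • s).re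
  · exact Or.inl h
  · right
    push Not at h
    rcases hs with hs | ⟨h1, h2, h3⟩
    · have hs' : 1 ≤ s.re := hs
      exfalso; nlinarith
    · refine ⟨?_, h, ?_⟩
      · rw [hre]; nlinarith
      · rw [him, abs_mul, abs_of_nonneg hb]
        exact (mul_le_of_le_one_left (abs_nonneg _) (by linarith)).trans h3

lemma exp_eulerLog {m : ℕ} {c : ℕ → Fin m → ℂ} {L : ℂ → ℂ} (hL : HasEulerProduct c L) {s : ℂ}
    (hs : 1 < s.re) : Complex.exp (eulerLog c s) = L s := by
  refine HasProd.unique ?_ (hL.2 s hs)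
  refine (hasSum_eulerLog hL.1 hs).cexp.congr_fun fun p => ?_
  rw [Function.comp_apply, Complex.exp_sum]
  refine Finset.prod_congr rfl fun j _ => ?_
  rw [Complex.exp_neg, Complex.exp_log]
  have h := (norm_eulerRoot_le hL.1 p j s).trans (prime_rpow_neg_le_half p hs.le)
  intro h0
  rw [sub_eq_zero] at h0
  rw [← h0, norm_one] at h
  norm_num at h

/-- Two holomorphic logarithms of the same function differ by a constant. -/
lemma exists_const_of_exp_eq {f g : ℂ → ℂ} {U : Set ℂ} (hU : IsOpen U) (hUc : IsPreconnected U)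
    (hf : DifferentiableOn ℂ f U) (hg : DifferentiableOn ℂ g U)
    (h : ∀ s ∈ U, Complex.exp (f s) = Complex.exp (g s)) : ∃ a, ∀ s ∈ U, f s - g s = a := by
  refine hU.exists_is_const_of_deriv_eq_zero hUc (hf.sub hg) fun s hs => ?_
  have hfs := (hf.differentiableAt (hU.mem_nhds hs)).hasDerivAt
  have hgs := (hg.differentiableAt (hU.mem_nhds hs)).hasDerivAt
  have he : (fun s => Complex.exp (f s)) =ᶠ[nhds s] fun s => Complex.exp (g s) :=
    Filter.eventually_of_mem (hU.mem_nhds hs) h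
  have h1 := hfs.cexp.unique (hgs.cexp.congr_of_eventuallyEq he)
  rw [h s hs] at h1
  have h2 := mul_left_cancel₀ (Complex.exp_ne_zero _) h1
  change deriv (fun s => f s - g s) s = 0
  rw [(hfs.fun_sub hgs).deriv, h2, sub_self]

theorem exists_isLogOfL {m : ℕ} {c : ℕ → Fin m → ℂ} {L : ℂ → ℂ} {δ : ℝ} {N : ℕ}
    (hL : HasEulerProduct c L) (hδ : 0 ≤ δ) (ha : AnalyticOnNhd ℂ L (zeroFreeRegion δ N))
    (h0 : ∀ s ∈ zeroFreeRegion δ N, L s ≠ 0) : ∃ logL : ℂ → ℂ, IsLogOfL c L δ N logL := by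
  have h2 : (2 : ℂ) ∈ zeroFreeRegion δ N := Or.inl (by simp)
  obtain ⟨g, hg, hge⟩ := exists_analyticOnNhd_log (starConvex_zeroFreeRegion hδ N) ⟨2, h2⟩ ha h0
  have hsub : ∀ s : ℂ, 1 < s.re → s ∈ zeroFreeRegion δ N := fun s hs => Or.inl (le_of_lt hs)
  obtain ⟨a, hga⟩ := exists_const_of_exp_eq (U := {s : ℂ | 1 < s.re})
    (isOpen_lt continuous_const Complex.continuous_re) (convex_halfSpace_re_gt 1).isPreconnected
    (fun s hs => (hg s (hsub s hs)).differentiableAt.differentiableWithinAt)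
    (fun s hs => (differentiableAt_eulerLog hL.1 hs).differentiableWithinAt)
    (fun s hs => by rw [hge s (hsub s hs), exp_eulerLog hL hs])
  have hexp : Complex.exp a = 1 := by
    rw [← hga 2 (by simp), Complex.exp_sub, hge 2 h2, exp_eulerLog hL (by simp), div_self (h0 2 h2)]
  refine ⟨fun s => g s - a, hg.sub analyticOnNhd_const, fun s hs => ?_, fun s hs => ?_⟩
  · rw [Complex.exp_sub, hexp, div_one, hge s hs]
  · have : g s - a = eulerLog c s := by rw [← hga s hs]; ring
    exact this ▸ hasSum_eulerLog hL.1 hs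

/-! ### Cauchy's integral formula on a rectangle -/

/-- The integral of `f` over the positively oriented boundary of the rectangle
`[a, b] × [-H, H]`. -/
noncomputable def rectIntegral (f : ℂ → ℂ) (a b H : ℝ) : ℂ :=
  (∫ x in a..b, f (x + (-H : ℝ) * I)) - (∫ x in a..b, f (x + H * I))
    + I * (∫ v in (-H)..H, f (b + v * I)) - I * (∫ v in (-H)..H, f (a + v * I))

lemma hasDerivAt_horizontal (v x : ℝ) :
    HasDerivAt (fun x : ℝ => (x : ℂ) + v * I) 1 x :=
  (Complex.ofRealCLM.hasDerivAt (x := x)).add_const _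

lemma hasDerivAt_vertical (x v : ℝ) :
    HasDerivAt (fun v : ℝ => (x : ℂ) + v * I) I v := by
  simpa using ((Complex.ofRealCLM.hasDerivAt (x := v)).mul_const I).const_add (x : ℂ)

/-- The winding number of the rectangle around `0`, computed with the principal logarithm on three
sides and with `log (-s)` on the left side, which crosses the branch cut. -/
lemma rectIntegral_inv {a b H : ℝ} (ha : a < 0) (hb : 0 < b) (hH : 0 < H) :
    rectIntegral (fun s => s⁻¹) a b H = 2 * Real.pi * I := by
  have hor : ∀ v : ℝ, v ≠ 0 → (∫ x in a..b, ((x : ℂ) + v * I)⁻¹)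
      = Complex.log (b + v * I) - Complex.log (a + v * I) := by
    intro v hv
    have hs : ∀ x : ℝ, (x : ℂ) + v * I ∈ Complex.slitPlane := fun x => Or.inr (by simpa using hv)
    refine intervalIntegral.integral_eq_sub_of_hasDerivAt
      (f := fun x : ℝ => Complex.log ((x : ℂ) + v * I)) (fun x _ => ?_) ?_
    · simpa using (hasDerivAt_horizontal v x).clog_real (hs x)
    · refine Continuous.intervalIntegrable ?_ _ _
      exact Continuous.inv₀ (by fun_prop) fun x => Complex.slitPlane_ne_zero (hs x)
  have vert : ∀ x : ℝ, 0 < x → I * (∫ v in (-H)..H, ((x : ℂ) + v * I)⁻¹)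
      = Complex.log (x + H * I) - Complex.log (x + (-H : ℝ) * I) := by
    intro x hx
    have hs : ∀ v : ℝ, (x : ℂ) + v * I ∈ Complex.slitPlane := fun v => Or.inl (by simpa using hx)
    rw [← intervalIntegral.integral_const_mul]
    refine intervalIntegral.integral_eq_sub_of_hasDerivAt
      (f := fun v : ℝ => Complex.log ((x : ℂ) + v * I)) (fun v _ => ?_) ?_
    · simpa [div_eq_mul_inv] using (hasDerivAt_vertical x v).clog_real (hs v)
    · refine Continuous.intervalIntegrable ?_ _ _
      exact continuous_const.mul
        (Continuous.inv₀ (by fun_prop) fun v => Complex.slitPlane_ne_zero (hs v))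
  have vert' : I * (∫ v in (-H)..H, ((a : ℂ) + v * I)⁻¹)
      = Complex.log (-(a + H * I)) - Complex.log (-(a + (-H : ℝ) * I)) := by
    have hs : ∀ v : ℝ, -((a : ℂ) + v * I) ∈ Complex.slitPlane := fun v => Or.inl (by simpa using ha)
    have hs0 : ∀ v : ℝ, (a : ℂ) + v * I ≠ 0 := fun v =>
      neg_ne_zero.mp (Complex.slitPlane_ne_zero (hs v))
    rw [← intervalIntegral.integral_const_mul]
    refine intervalIntegral.integral_eq_sub_of_hasDerivAt
      (f := fun v : ℝ => Complex.log (-((a : ℂ) + v * I))) (fun v _ => ?_) ?_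
    · have := (hasDerivAt_vertical a v).fun_neg.clog_real (hs v)
      rwa [neg_div_neg_eq, div_eq_mul_inv] at this
    · refine Continuous.intervalIntegrable ?_ _ _
      exact continuous_const.mul (Continuous.inv₀ (by fun_prop) hs0)
  -- The principal logarithms of `z` and `-z` differ by `π i`; this happens at both left corners.
  have hneg : ∀ z : ℂ, 0 < z.im → Complex.log (-z) = Complex.log z - Real.pi * I := by
    intro z hz
    rw [Complex.log, Complex.log, norm_neg, Complex.arg_neg_eq_arg_sub_pi_of_im_pos hz]
    push_cast; ring
  have h1 := hneg (a + H * I) (by simpa using hH)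
  have h2 := hneg (-(a + (-H : ℝ) * I)) (by simpa using hH)
  rw [neg_neg] at h2
  rw [rectIntegral, hor _ (neg_ne_zero.mpr hH.ne'),
    hor _ hH.ne', vert b hb, vert', h1, h2]
  ring

lemma rectIntegral_sub_inv {a b H α : ℝ} (ha : a < α) (hb : α < b) (hH : 0 < H) :
    rectIntegral (fun s => (s - α)⁻¹) a b H = 2 * Real.pi * I := by
  rw [← rectIntegral_inv (sub_neg.mpr ha) (sub_pos.mpr hb) hH, rectIntegral, rectIntegral]
  have hh : ∀ v : ℝ, (∫ x in a..b, ((x : ℂ) + v * I - α)⁻¹)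
      = ∫ x in (a - α)..(b - α), ((x : ℂ) + v * I)⁻¹ := by
    intro v
    rw [← intervalIntegral.integral_comp_sub_right (fun x : ℝ => ((x : ℂ) + v * I)⁻¹)]
    refine intervalIntegral.integral_congr fun x _ => ?_
    push_cast; congr 1; ring
  rw [hh, hh]
  simp only [Complex.ofReal_sub, sub_add_eq_add_sub]

/-- Cauchy's integral formula for a rectangle that is symmetric about the real axis and a real
point inside it. -/
theorem rectIntegral_div_sub {f : ℂ → ℂ} {a b H α : ℝ} (ha : a < α) (hb : α < b) (hH : 0 < H)
    (hf : ∀ s : ℂ, a ≤ s.re → s.re ≤ b → |s.im| ≤ H → DifferentiableAt ℂ f s) :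
    rectIntegral (fun s => f s * (s - α)⁻¹) a b H = 2 * Real.pi * I * f α := by
  have hab : a ≤ b := by linarith
  have hHH : -H ≤ H := by linarith
  let R : Set ℂ := Set.Icc a b ×ℂ Set.Icc (-H) H
  have hR : ∀ s ∈ R, DifferentiableAt ℂ f s := fun s hs =>
    hf s hs.1.1 hs.1.2 (abs_le.mpr hs.2)
  have hRn : R ∈ nhds (α : ℂ) := by
    rw [← mem_interior_iff_mem_nhds, Complex.interior_reProdIm, interior_Icc, interior_Icc]
    exact ⟨by simp [ha, hb], by simp [hH]⟩
  have hd : DifferentiableOn ℂ (dslope f α) R :=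
    (Complex.differentiableOn_dslope hRn).mpr fun s hs => (hR s hs).differentiableWithinAt
  have hz := Complex.integral_boundary_rect_eq_zero_of_differentiableOn (dslope f α)
    ⟨a, -H⟩ ⟨b, H⟩ (by simpa only [Set.uIcc_of_le hab, Set.uIcc_of_le hHH] using hd)
  have hcong : ∀ s : ℂ, s ≠ α → f s * (s - α)⁻¹ = dslope f α s + f α * (s - α)⁻¹ := by
    intro s hs
    have : s - α ≠ 0 := sub_ne_zero.mpr hs
    rw [dslope_of_ne _ hs, slope_def_field]
    field_simp
    ring
  have hmemh : ∀ v : ℝ, |v| ≤ H → ∀ x ∈ Set.uIcc a b, (x : ℂ) + v * I ∈ R := by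
    intro v hv x hx
    rw [Set.uIcc_of_le hab] at hx
    exact ⟨by simpa using hx, by simpa using abs_le.mp hv⟩
  have hmemv : ∀ x : ℝ, a ≤ x → x ≤ b → ∀ v ∈ Set.uIcc (-H) H, (x : ℂ) + v * I ∈ R := by
    intro x hx hx' v hv
    rw [Set.uIcc_of_le hHH] at hv
    exact ⟨by simp [hx, hx'], by simpa using hv⟩
  have hh : ∀ v : ℝ, v ≠ 0 → |v| ≤ H → (∫ x in a..b, f (x + v * I) * ((x : ℂ) + v * I - α)⁻¹)
      = (∫ x in a..b, dslope f α (x + v * I)) + f α * ∫ x in a..b, ((x : ℂ) + v * I - α)⁻¹ := by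
    intro v hv hvH
    have hne : ∀ x : ℝ, (x : ℂ) + v * I ≠ α := fun x h => hv (by simpa using congrArg Complex.im h)
    rw [← intervalIntegral.integral_const_mul, ← intervalIntegral.integral_add]
    · exact intervalIntegral.integral_congr fun x _ => hcong _ (hne x)
    · exact (hd.continuousOn.comp (by fun_prop) (hmemh v hvH)).intervalIntegrable
    · refine Continuous.intervalIntegrable ?_ _ _
      exact continuous_const.mul
        (Continuous.inv₀ (by fun_prop) fun x => sub_ne_zero.mpr (hne x))
  have hv : ∀ x : ℝ, x ≠ α → a ≤ x → x ≤ b →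
      (∫ v in (-H)..H, f (x + v * I) * ((x : ℂ) + v * I - α)⁻¹)
      = (∫ v in (-H)..H, dslope f α (x + v * I))
        + f α * ∫ v in (-H)..H, ((x : ℂ) + v * I - α)⁻¹ := by
    intro x hx hax hxb
    have hne : ∀ v : ℝ, (x : ℂ) + v * I ≠ α := fun v h => hx (by simpa using congrArg Complex.re h)
    rw [← intervalIntegral.integral_const_mul, ← intervalIntegral.integral_add]
    · exact intervalIntegral.integral_congr fun v _ => hcong _ (hne v)
    · exact (hd.continuousOn.comp (by fun_prop) (hmemv x hax hxb)).intervalIntegrable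
    · refine Continuous.intervalIntegrable ?_ _ _
      exact continuous_const.mul
        (Continuous.inv₀ (by fun_prop) fun x => sub_ne_zero.mpr (hne x))
  have hk := rectIntegral_sub_inv ha hb hH
  rw [rectIntegral] at hk
  simp only [smul_eq_mul] at hz
  rw [rectIntegral, hh (-H) (neg_ne_zero.mpr hH.ne') (by rw [abs_neg, abs_of_pos hH]), hh H hH.ne'
    (abs_of_pos hH).le, hv a ha.ne le_rfl hab, hv b hb.ne' hab le_rfl]
  linear_combination hz + f α * hk

/-! ### The contour estimate -/

lemma integral_inv_add_abs {d H : ℝ} (hd : 0 < d) (hH : 0 ≤ H) :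
    ∫ v in (-H)..H, (d + |v|)⁻¹ = 2 * Real.log (1 + H / d) := by
  have hc : Continuous fun v : ℝ => (d + |v|)⁻¹ :=
    Continuous.inv₀ (by fun_prop) fun v => (by positivity : d + |v| ≠ 0)
  have h1 : ∫ v in (0 : ℝ)..H, (d + |v|)⁻¹ = Real.log (1 + H / d) := by
    have : ∫ v in (0 : ℝ)..H, (d + |v|)⁻¹ = ∫ v in (0 : ℝ)..H, (d + v)⁻¹ := by
      refine intervalIntegral.integral_congr fun v hv => ?_
      rw [Set.uIcc_of_le hH] at hv
      simp only [abs_of_nonneg hv.1]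
    rw [this, intervalIntegral.integral_comp_add_left (fun v => v⁻¹), add_zero,
      integral_inv_of_pos hd (by linarith)]
    congr 1
    field_simp
  have h2 : ∫ v in (-H)..0, (d + |v|)⁻¹ = ∫ v in (0 : ℝ)..H, (d + |v|)⁻¹ := by
    have := intervalIntegral.integral_comp_neg (a := 0) (b := H) (fun v : ℝ => (d + |v|)⁻¹)
    simpa using this.symm
  rw [← intervalIntegral.integral_add_adjacent_intervals (hc.intervalIntegrable _ 0)
    (hc.intervalIntegrable 0 _), h2, h1]
  ring

/-- The kernel `Y^{s-α} (1 + ((s-1)/H)²)`. On the lines `|Im s| = H` the second factor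
is `O(|Re s - 1| / H)`, which compensates bounds that blow up like `1 / |Re s - 1|`. -/
noncomputable def contourKernel (Y H α : ℝ) (s : ℂ) : ℂ :=
  (Y : ℂ) ^ (s - α) * (1 + ((s - 1) / H) ^ 2)

section

variable {Y H α : ℝ}

lemma differentiable_contourKernel (hY : 0 < Y) : Differentiable ℂ (contourKernel Y H α) := by
  intro s
  have : (Y : ℂ) ≠ 0 := mod_cast hY.ne'
  unfold contourKernel
  exact ((differentiableAt_id.sub_const _).const_cpow (Or.inl this)).mul (by fun_prop)

lemma norm_contourKernel_horizontal_le (hY : 0 < Y) (hH : 0 < H) {s : ℂ} (him : |s.im| = H)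
    (hre : |s.re - 1| ≤ H) :
    ‖contourKernel Y H α s‖ ≤ Y ^ (s.re - α) * (3 * |s.re - 1| / H) := by
  rw [contourKernel, norm_mul, Complex.norm_cpow_eq_rpow_re_of_pos hY]
  simp only [Complex.sub_re, Complex.ofReal_re]
  gcongr
  have hH0 : (H : ℂ) ≠ 0 := mod_cast hH.ne'
  have hs1 : s - 1 = ((s.re - 1 : ℝ) : ℂ) + s.im * I := by apply Complex.ext <;> simp
  have him2 : (s.im : ℂ) ^ 2 = (H : ℂ) ^ 2 := by
    rw [← him]; norm_cast; rw [sq_abs]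
  have key : 1 + ((s - 1) / H) ^ 2
      = ((s.re - 1 : ℝ) : ℂ) * (((s.re - 1 : ℝ) : ℂ) + 2 * s.im * I) / (H : ℂ) ^ 2 := by
    rw [hs1]
    field_simp
    linear_combination (s.im : ℂ) ^ 2 * Complex.I_sq - him2
  rw [key, norm_div, norm_mul, Complex.norm_real, norm_pow, Complex.norm_real, Real.norm_eq_abs,
    Real.norm_eq_abs, abs_of_pos hH]
  have h3 : ‖((s.re - 1 : ℝ) : ℂ) + 2 * s.im * I‖ ≤ 3 * H := by
    refine (norm_add_le _ _).trans ?_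
    simp only [norm_mul, Complex.norm_real, Real.norm_eq_abs, Complex.norm_I, him]
    norm_num
    linarith
  rw [div_le_div_iff₀ (by positivity) hH]
  have : |s.re - 1| * ‖((s.re - 1 : ℝ) : ℂ) + 2 * s.im * I‖ * H ≤ |s.re - 1| * (3 * H) * H := by
    gcongr
  linarith

lemma norm_contourKernel_le (hY : 0 < Y) (hH : 0 < H) {s : ℂ} (him : |s.im| ≤ H)
    (hre : |s.re - 1| ≤ H) :
    ‖contourKernel Y H α s‖ ≤ Y ^ (s.re - α) * 3 := by
  rw [contourKernel, norm_mul, Complex.norm_cpow_eq_rpow_re_of_pos hY]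
  simp only [Complex.sub_re, Complex.ofReal_re]
  gcongr
  refine (norm_add_le _ _).trans ?_
  have h1 : ‖s - 1‖ ^ 2 ≤ 2 * H ^ 2 := by
    rw [Complex.sq_norm, Complex.normSq_apply]
    have h1 := sq_le_sq' (abs_le.mp him).1 (abs_le.mp him).2
    have h2 := sq_le_sq' (abs_le.mp hre).1 (abs_le.mp hre).2
    simp only [Complex.sub_re, Complex.one_re, Complex.sub_im, Complex.one_im, sub_zero]
    nlinarith
  rw [norm_one, norm_pow, norm_div, Complex.norm_real, Real.norm_eq_abs, abs_of_pos hH, div_pow]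
  have : ‖s - 1‖ ^ 2 / H ^ 2 ≤ 2 := by rw [div_le_iff₀ (by positivity)]; exact h1
  linarith

lemma norm_integrand_horizontal_le (hY : 0 < Y) (hH : 0 < H) {s : ℂ} (him : |s.im| = H)
    (hre : |s.re - 1| ≤ H) (f : ℂ) :
    ‖f * contourKernel Y H α s * (s - α)⁻¹‖
      ≤ ‖f‖ * (Y ^ (s.re - α) * (3 * |s.re - 1| / H)) / H := by
  rw [norm_mul, norm_mul, norm_inv, ← div_eq_mul_inv]
  have h : H ≤ ‖s - α‖ := by
    refine le_trans ?_ (Complex.abs_im_le_norm _)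
    simp [him]
  gcongr
  exact norm_contourKernel_horizontal_le hY hH him hre

lemma norm_integrand_vertical_le (hY : 0 < Y) (hH : 0 < H) {s : ℂ} (him : |s.im| ≤ H)
    (hre : |s.re - 1| ≤ H) (f : ℂ) {r : ℝ} (hr : 0 < r) (hrs : r ≤ ‖s - α‖) :
    ‖f * contourKernel Y H α s * (s - α)⁻¹‖ ≤ ‖f‖ * (Y ^ (s.re - α) * 3) / r := by
  rw [norm_mul, norm_mul, norm_inv, ← div_eq_mul_inv]
  gcongr
  exact norm_contourKernel_le hY hH him hre

end

/-- Newman's contour argument. On the right of `Re s = 1` the difference `P - S` is integrated; on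
the left `P` and `S` are treated separately, `S` being entire. -/
theorem norm_sub_le_of_contour {P S : ℂ → ℂ} {A B Y H α b : ℝ} (hY1 : 1 ≤ Y) (hH : 4 ≤ H)
    (hA : 0 ≤ A) (hB : 0 ≤ B) (hb : 0 < b) (hb1 : b ≤ 1) (hα : 1 - b < α) (hα2 : α ≤ 2)
    (hP : ∀ s : ℂ, 1 - b ≤ s.re → s.re ≤ 1 + H → |s.im| ≤ H → DifferentiableAt ℂ P s)
    (hS : Differentiable ℂ S)
    (hright : ∀ s : ℂ, 1 < s.re → ‖P s - S s‖ ≤ B * Y ^ (1 - s.re) / (s.re - 1))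
    (hleft : ∀ s : ℂ, s.re < 1 → 1 - H ≤ s.re → ‖S s‖ ≤ B * Y ^ (1 - s.re) / (1 - s.re))
    (hPb : ∀ s : ℂ, 1 - b ≤ s.re → s.re ≤ 1 → |s.im| ≤ H → ‖P s‖ ≤ A) :
    ‖P α - S α‖ ≤ (36 * B + 6 * A * b / H) / H * Y ^ (1 - α)
      + 12 * A * Y ^ (1 - b - α) * Real.log (1 + H / (α - (1 - b))) := by
  have hY : 0 < Y := by linarith
  have hH0 : 0 < H := by linarith
  set k := contourKernel Y H α with hk
  have hkd : Differentiable ℂ k := differentiable_contourKernel hY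
  let gP : ℂ → ℂ := fun s => P s * k s * (s - α)⁻¹
  let gS : ℂ → ℂ := fun s => S s * k s * (s - α)⁻¹
  have hcP : ∀ s : ℂ, 1 - b ≤ s.re → s.re ≤ 1 + H → |s.im| ≤ H → s ≠ α → ContinuousAt gP s := by
    intro s h1 h2 h3 h4
    exact ((hP s h1 h2 h3).continuousAt.mul hkd.continuous.continuousAt).mul
      ((continuousAt_id.sub continuousAt_const).inv₀ (sub_ne_zero.mpr h4))
  have hcS : ∀ s : ℂ, s ≠ α → ContinuousAt gS s := by
    intro s h4
    exact (hS.continuous.continuousAt.mul hkd.continuous.continuousAt).mul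
      ((continuousAt_id.sub continuousAt_const).inv₀ (sub_ne_zero.mpr h4))
  -- The two applications of Cauchy's formula.
  have hIP : rectIntegral gP (1 - b) (1 + H) H = 2 * Real.pi * I * (P α * k α) :=
    rectIntegral_div_sub hα (by linarith) hH0
      fun s h1 h2 h3 => (hP s h1 h2 h3).mul hkd.differentiableAt
  have hIS : rectIntegral gS (1 - H) (1 + H) H = 2 * Real.pi * I * (S α * k α) :=
    rectIntegral_div_sub (by linarith) (by linarith) hH0
      fun s _ _ _ => hS.differentiableAt.mul hkd.differentiableAt
  -- Integrability along the sides.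
  have hneH : ∀ v : ℝ, |v| = H → ∀ x : ℝ, (x : ℂ) + v * I ≠ α := by
    intro v hv x h
    have := congrArg Complex.im h
    simp at this
    rw [this, abs_zero] at hv
    linarith
  have hiP : ∀ v : ℝ, |v| = H → ∀ x₁ x₂ : ℝ, 1 - b ≤ x₁ → x₁ ≤ x₂ → x₂ ≤ 1 + H →
      IntervalIntegrable (fun x : ℝ => gP (x + v * I)) MeasureTheory.volume x₁ x₂ := by
    intro v hv x₁ x₂ h1 h2 h3
    refine ContinuousOn.intervalIntegrable fun x hx => ?_
    rw [Set.uIcc_of_le h2] at hx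
    refine ContinuousAt.continuousWithinAt (ContinuousAt.comp (g := gP)
      (hcP _ ?_ ?_ ?_ (hneH v hv x)) (by fun_prop))
    · simpa using h1.trans hx.1
    · simpa using hx.2.trans h3
    · simpa using hv.le
  have hiS : ∀ v : ℝ, |v| = H → ∀ x₁ x₂ : ℝ,
      IntervalIntegrable (fun x : ℝ => gS (x + v * I)) MeasureTheory.volume x₁ x₂ := by
    intro v hv x₁ x₂
    refine ContinuousOn.intervalIntegrable fun x hx => ?_
    exact ContinuousAt.continuousWithinAt (ContinuousAt.comp (g := gS) (hcS _ (hneH v hv x))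
      (by fun_prop))
  have hneR : ∀ v : ℝ, ((1 + H : ℝ) : ℂ) + v * I ≠ α := by
    intro v h
    have := congrArg Complex.re h
    simp at this
    linarith
  have hiPR : IntervalIntegrable (fun v : ℝ => gP ((1 + H : ℝ) + v * I)) MeasureTheory.volume
      (-H) H := by
    refine ContinuousOn.intervalIntegrable fun v hv => ?_
    rw [Set.uIcc_of_le (by linarith)] at hv
    refine ContinuousAt.continuousWithinAt (ContinuousAt.comp (g := gP) (hcP _ ?_ ?_ ?_ (hneR v))
      (by fun_prop))
    · simp; linarith
    · simp
    · simpa using abs_le.mpr hv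
  have hiSR : IntervalIntegrable (fun v : ℝ => gS ((1 + H : ℝ) + v * I)) MeasureTheory.volume
      (-H) H := by
    refine ContinuousOn.intervalIntegrable fun v hv => ?_
    exact ContinuousAt.continuousWithinAt (ContinuousAt.comp (g := gS) (hcS _ (hneR v))
      (by fun_prop))
  have hmul : ∀ s : ℂ, gP s - gS s = (P s - S s) * k s * (s - α)⁻¹ := fun s => by
    simp only [gP, gS]; ring
  have hYpos : ∀ x : ℝ, 0 < Y ^ x := fun x => Real.rpow_pos_of_pos hY x
  have hYmul : ∀ x y z : ℝ, x + y = z → Y ^ x * Y ^ y = Y ^ z := fun x y z h => by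
    rw [← Real.rpow_add hY, h]
  -- Bounds for the sides: `h`, `v` stand for horizontal and vertical, `R` for the common part
  -- to the right of `Re s = 1`, and `P`, `S` for the parts to the left of it.
  have hRh : ∀ v : ℝ, |v| = H → ‖(∫ x in (1 : ℝ)..(1 + H), gP (x + v * I))
      - ∫ x in (1 : ℝ)..(1 + H), gS (x + v * I)‖ ≤ 3 * B / H * Y ^ (1 - α) := by
    intro v hv
    rw [← intervalIntegral.integral_sub (hiP v hv _ _ (by linarith) (by linarith) le_rfl)
      (hiS v hv _ _)]
    have : ∀ x ∈ Set.uIoc (1 : ℝ) (1 + H), ‖gP (x + v * I) - gS (x + v * I)‖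
        ≤ 3 * B / H ^ 2 * Y ^ (1 - α) := by
      intro x hx
      rw [Set.uIoc_of_le (by linarith)] at hx
      have hx1 : 0 < x - 1 := by linarith [hx.1]
      rw [hmul]
      refine (norm_integrand_horizontal_le hY hH0 (by simpa using hv)
        (by simpa [abs_of_pos hx1] using by linarith [hx.2]) _).trans ?_
      have h1 := hright (x + v * I) (by simpa using hx.1)
      simp only [Complex.add_re, Complex.ofReal_re, Complex.mul_re, Complex.I_re, mul_zero,
        Complex.ofReal_im, Complex.I_im, mul_one, sub_self, add_zero] at h1 ⊢
      rw [abs_of_pos hx1]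
      calc _ ≤ B * Y ^ (1 - x) / (x - 1) * (Y ^ (x - α) * (3 * (x - 1) / H)) / H := by gcongr
        _ = 3 * B / H ^ 2 * (Y ^ (1 - x) * Y ^ (x - α)) := by field_simp
        _ = _ := by rw [hYmul _ _ (1 - α) (by ring)]
    refine (intervalIntegral.norm_integral_le_of_norm_le_const this).trans_eq ?_
    rw [add_sub_cancel_left, abs_of_pos hH0]; field_simp
  have hRv : ‖(∫ v in (-H)..H, gP ((1 + H : ℝ) + v * I))
      - ∫ v in (-H)..H, gS ((1 + H : ℝ) + v * I)‖ ≤ 12 * B / H * Y ^ (1 - α) := by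
    rw [← intervalIntegral.integral_sub hiPR hiSR]
    have : ∀ v ∈ Set.uIoc (-H) H, ‖gP ((1 + H : ℝ) + v * I) - gS ((1 + H : ℝ) + v * I)‖
        ≤ 6 * B / H ^ 2 * Y ^ (1 - α) := by
      intro v hv
      rw [Set.uIoc_of_le (by linarith)] at hv
      have h0 := hmul ((1 + H : ℝ) + v * I)
      rw [h0]
      refine (norm_integrand_vertical_le hY hH0 (r := H / 2)
        (by simpa using abs_le.mpr ⟨hv.1.le, hv.2⟩)
        (by simp [abs_of_pos hH0]) _ (by linarith) ?_).trans ?_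
      · refine le_trans ?_ (Complex.abs_re_le_norm _)
        refine le_trans ?_ (le_abs_self _)
        simp
        linarith
      have h1 := hright ((1 + H : ℝ) + v * I) (by simpa using hH0)
      simp only [Complex.add_re, Complex.ofReal_re, Complex.mul_re, Complex.I_re, mul_zero,
        Complex.ofReal_im, Complex.I_im, mul_one, sub_self, add_zero, add_sub_cancel_left] at h1 ⊢
      calc _ ≤ B * Y ^ (1 - (1 + H)) / H * (Y ^ (1 + H - α) * 3) / (H / 2) := by gcongr
        _ = 6 * B / H ^ 2 * (Y ^ (1 - (1 + H)) * Y ^ (1 + H - α)) := by field_simp; ring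
        _ = _ := by rw [hYmul _ _ (1 - α) (by ring)]
    refine (intervalIntegral.norm_integral_le_of_norm_le_const this).trans_eq ?_
    rw [sub_neg_eq_add, abs_of_pos (by linarith)]; field_simp; ring
  have hSh : ∀ v : ℝ, |v| = H → ‖∫ x in (1 - H)..(1 : ℝ), gS (x + v * I)‖
      ≤ 3 * B / H * Y ^ (1 - α) := by
    intro v hv
    have : ∀ x ∈ Set.uIoc (1 - H) (1 : ℝ), ‖gS (x + v * I)‖ ≤ 3 * B / H ^ 2 * Y ^ (1 - α) := by
      intro x hx
      rw [Set.uIoc_of_le (by linarith)] at hx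
      refine (norm_integrand_horizontal_le hY hH0 (by simpa using hv)
        (by simpa [abs_of_nonpos (sub_nonpos.mpr hx.2)] using by linarith [hx.1]) _).trans ?_
      simp only [Complex.add_re, Complex.ofReal_re, Complex.mul_re, Complex.I_re, mul_zero,
        Complex.ofReal_im, Complex.I_im, mul_one, sub_self, add_zero]
      rw [abs_of_nonpos (sub_nonpos.mpr hx.2), neg_sub]
      rcases hx.2.eq_or_lt with rfl | hx1
      · simp only [sub_self, mul_zero, zero_div]
        have := hYpos (1 - α)
        positivity
      have hx1' : 0 < 1 - x := by linarith
      have h1 := hleft (x + v * I) (by simpa using hx1) (by simpa using hx.1.le)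
      simp only [Complex.add_re, Complex.ofReal_re, Complex.mul_re, Complex.I_re, mul_zero,
        Complex.ofReal_im, Complex.I_im, mul_one, sub_self, add_zero] at h1
      calc _ ≤ B * Y ^ (1 - x) / (1 - x) * (Y ^ (x - α) * (3 * (1 - x) / H)) / H := by gcongr
        _ = 3 * B / H ^ 2 * (Y ^ (1 - x) * Y ^ (x - α)) := by field_simp
        _ = _ := by rw [hYmul _ _ (1 - α) (by ring)]
    refine (intervalIntegral.norm_integral_le_of_norm_le_const this).trans_eq ?_
    rw [sub_sub_cancel, abs_of_pos hH0]; field_simp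
  have hSv : ‖∫ v in (-H)..H, gS ((1 - H : ℝ) + v * I)‖ ≤ 12 * B / H * Y ^ (1 - α) := by
    have : ∀ v ∈ Set.uIoc (-H) H, ‖gS ((1 - H : ℝ) + v * I)‖ ≤ 6 * B / H ^ 2 * Y ^ (1 - α) := by
      intro v hv
      rw [Set.uIoc_of_le (by linarith)] at hv
      refine (norm_integrand_vertical_le hY hH0 (r := H / 2)
        (by simpa using abs_le.mpr ⟨hv.1.le, hv.2⟩)
        (by simp [abs_of_pos hH0]) _ (by linarith) ?_).trans ?_
      · refine le_trans ?_ (Complex.abs_re_le_norm _)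
        refine le_trans ?_ (neg_le_abs _)
        simp
        linarith
      have h1 := hleft ((1 - H : ℝ) + v * I) (by simpa using hH0) (by simp)
      simp only [Complex.add_re, Complex.ofReal_re, Complex.mul_re, Complex.I_re, mul_zero,
        Complex.ofReal_im, Complex.I_im, mul_one, sub_self, add_zero, sub_sub_cancel] at h1 ⊢
      calc _ ≤ B * Y ^ H / H * (Y ^ (1 - H - α) * 3) / (H / 2) := by gcongr
        _ = 6 * B / H ^ 2 * (Y ^ H * Y ^ (1 - H - α)) := by field_simp; ring
        _ = _ := by rw [hYmul _ _ (1 - α) (by ring)]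
    refine (intervalIntegral.norm_integral_le_of_norm_le_const this).trans_eq ?_
    rw [sub_neg_eq_add, abs_of_pos (by linarith)]; field_simp; ring
  have hPh : ∀ v : ℝ, |v| = H → ‖∫ x in (1 - b)..(1 : ℝ), gP (x + v * I)‖
      ≤ 3 * A * b / H ^ 2 * Y ^ (1 - α) := by
    intro v hv
    have : ∀ x ∈ Set.uIoc (1 - b) (1 : ℝ), ‖gP (x + v * I)‖ ≤ 3 * A / H ^ 2 * Y ^ (1 - α) := by
      intro x hx
      rw [Set.uIoc_of_le (by linarith)] at hx
      have hx1 : 0 ≤ 1 - x := by linarith [hx.2]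
      refine (norm_integrand_horizontal_le hY hH0 (by simpa using hv)
        (by simpa [abs_of_nonpos (sub_nonpos.mpr hx.2)] using by linarith [hx.1]) _).trans ?_
      have h1 := hPb (x + v * I) (by simpa using hx.1.le) (by simpa using hx.2)
        (by simpa using hv.le)
      simp only [Complex.add_re, Complex.ofReal_re, Complex.mul_re, Complex.I_re, mul_zero,
        Complex.ofReal_im, Complex.I_im, mul_one, sub_self, add_zero]
      rw [abs_of_nonpos (sub_nonpos.mpr hx.2), neg_sub]
      calc _ ≤ A * (Y ^ (1 - α) * (3 * 1 / H)) / H := by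
            gcongr
            · exact hx.2
            · linarith [hx.1]
        _ = _ := by field_simp
    refine (intervalIntegral.norm_integral_le_of_norm_le_const this).trans_eq ?_
    rw [sub_sub_cancel, abs_of_pos hb]; field_simp
  have hPv : ‖∫ v in (-H)..H, gP ((1 - b : ℝ) + v * I)‖
      ≤ 12 * A * Y ^ (1 - b - α) * Real.log (1 + H / (α - (1 - b))) := by
    set d := α - (1 - b) with hd
    have hd0 : 0 < d := by rw [hd]; linarith
    have : ∀ v ∈ Set.Ioc (-H) H, ‖gP ((1 - b : ℝ) + v * I)‖
        ≤ 6 * A * Y ^ (1 - b - α) * (d + |v|)⁻¹ := by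
      intro v hv
      have hvH : |v| ≤ H := abs_le.mpr ⟨hv.1.le, hv.2⟩
      have hdv : 0 < d + |v| := by positivity
      refine (norm_integrand_vertical_le hY hH0 (r := (d + |v|) / 2) (by simpa using hvH)
        (by simpa [abs_of_pos hb] using by linarith) _ (by linarith) ?_).trans ?_
      · have h1 := Complex.abs_re_le_norm (((1 - b : ℝ) : ℂ) + v * I - α)
        have h2 := Complex.abs_im_le_norm (((1 - b : ℝ) : ℂ) + v * I - α)
        have h3 := (neg_le_abs _).trans h1
        simp at h2 h3 ⊢
        linarith
      have h1 := hPb ((1 - b : ℝ) + v * I) (by simp) (by simpa using hb.le) (by simpa using hvH)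
      simp only [Complex.add_re, Complex.ofReal_re, Complex.mul_re, Complex.I_re, mul_zero,
        Complex.ofReal_im, Complex.I_im, mul_one, sub_self, add_zero]
      calc _ ≤ A * (Y ^ (1 - b - α) * 3) / ((d + |v|) / 2) := by gcongr
        _ = _ := by field_simp; ring
    have hc : Continuous fun v : ℝ => 6 * A * Y ^ (1 - b - α) * (d + |v|)⁻¹ :=
      continuous_const.mul (Continuous.inv₀ (by fun_prop) fun v => (by positivity : d + |v| ≠ 0))
    refine (intervalIntegral.norm_integral_le_of_norm_le (by linarith)
      (Filter.Eventually.of_forall this) (hc.intervalIntegrable _ _)).trans_eq ?_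
    rw [intervalIntegral.integral_const_mul, integral_inv_add_abs hd0 hH0.le]
    ring
  -- The common right part of the two contours is combined.
  have hsplitP : ∀ v : ℝ, |v| = H → (∫ x in (1 - b)..(1 + H), gP (x + v * I))
      = (∫ x in (1 - b)..(1 : ℝ), gP (x + v * I)) + ∫ x in (1 : ℝ)..(1 + H), gP (x + v * I) :=
    fun v hv => (intervalIntegral.integral_add_adjacent_intervals
      (hiP v hv _ _ le_rfl (by linarith) (by linarith))
      (hiP v hv _ _ (by linarith) (by linarith) le_rfl)).symm
  have hsplitS : ∀ v : ℝ, |v| = H → (∫ x in (1 - H)..(1 + H), gS (x + v * I))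
      = (∫ x in (1 - H)..(1 : ℝ), gS (x + v * I)) + ∫ x in (1 : ℝ)..(1 + H), gS (x + v * I) :=
    fun v hv => (intervalIntegral.integral_add_adjacent_intervals (hiS v hv _ _)
      (hiS v hv _ _)).symm
  have hn : |-H| = H := by rw [abs_neg, abs_of_pos hH0]
  have hp : |H| = H := abs_of_pos hH0
  rw [rectIntegral, hsplitP _ hn, hsplitP _ hp] at hIP
  rw [rectIntegral, hsplitS _ hn, hsplitS _ hp] at hIS
  have e1 := hRh _ hn
  have e2 := hRh _ hp
  have e3 := hSh _ hn
  have e4 := hSh _ hp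
  have e5 := hPh _ hn
  have e6 := hPh _ hp
  generalize (∫ x in (1 : ℝ)..(1 + H), gP (x + (-H : ℝ) * I)) = p1 at *
  generalize (∫ x in (1 : ℝ)..(1 + H), gP (x + H * I)) = p2 at *
  generalize (∫ x in (1 : ℝ)..(1 + H), gS (x + (-H : ℝ) * I)) = s1 at *
  generalize (∫ x in (1 : ℝ)..(1 + H), gS (x + H * I)) = s2 at *
  generalize (∫ x in (1 - b)..(1 : ℝ), gP (x + (-H : ℝ) * I)) = p3 at *
  generalize (∫ x in (1 - b)..(1 : ℝ), gP (x + H * I)) = p4 at *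
  generalize (∫ x in (1 - H)..(1 : ℝ), gS (x + (-H : ℝ) * I)) = s3 at *
  generalize (∫ x in (1 - H)..(1 : ℝ), gS (x + H * I)) = s4 at *
  generalize (∫ v in (-H)..H, gP ((1 + H : ℝ) + v * I)) = p5 at *
  generalize (∫ v in (-H)..H, gP ((1 - b : ℝ) + v * I)) = p6 at *
  generalize (∫ v in (-H)..H, gS ((1 + H : ℝ) + v * I)) = s5 at *
  generalize (∫ v in (-H)..H, gS ((1 - H : ℝ) + v * I)) = s6 at *
  have hsum : 2 * Real.pi * I * ((P α - S α) * k α)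
      = ((p1 - s1) - (p2 - s2) + I * (p5 - s5)) + (p3 - p4 - I * p6) - (s3 - s4 - I * s6) := by
    linear_combination hIS - hIP
  have hnorm : ‖2 * Real.pi * I * ((P α - S α) * k α)‖
      ≤ (‖p1 - s1‖ + ‖p2 - s2‖ + ‖p5 - s5‖) + (‖p3‖ + ‖p4‖ + ‖p6‖) + (‖s3‖ + ‖s4‖ + ‖s6‖) := by
    have hI : ∀ z : ℂ, ‖I * z‖ = ‖z‖ := fun z => by rw [norm_mul, Complex.norm_I, one_mul]
    rw [hsum, ← hI (p5 - s5), ← hI p6, ← hI s6]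
    refine (norm_sub_le _ _).trans (add_le_add ((norm_add_le _ _).trans (add_le_add ?_ ?_)) ?_)
    · exact (norm_add_le _ _).trans (add_le_add_left (norm_sub_le _ _) _)
    · exact (norm_sub_le _ _).trans (add_le_add_left (norm_sub_le _ _) _)
    · exact (norm_sub_le _ _).trans (add_le_add_left (norm_sub_le _ _) _)
  have hkα : 1 ≤ ‖k α‖ := by
    have : k α = ((1 + ((α - 1) / H) ^ 2 : ℝ) : ℂ) := by
      rw [hk, contourKernel, sub_self, Complex.cpow_zero, one_mul]; push_cast; ring
    rw [this, Complex.norm_real]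
    refine le_trans ?_ (le_abs_self _)
    nlinarith [sq_nonneg ((α - 1) / H)]
  have hlow : ‖P α - S α‖ ≤ ‖2 * Real.pi * I * ((P α - S α) * k α)‖ := by
    simp only [norm_mul, Complex.norm_I, Complex.norm_real, Complex.norm_ofNat, Real.norm_eq_abs,
      abs_of_pos Real.pi_pos, mul_one]
    have h0 := norm_nonneg (P α - S α)
    have h2 : 1 ≤ 2 * Real.pi := by linarith [Real.pi_gt_three]
    calc ‖P α - S α‖ = 1 * (‖P α - S α‖ * 1) := by ring
      _ ≤ 2 * Real.pi * (‖P α - S α‖ * ‖k α‖) := by gcongr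
  have hfin : (36 * B + 6 * A * b / H) / H * Y ^ (1 - α)
      = 4 * (3 * B / H * Y ^ (1 - α)) + 2 * (12 * B / H * Y ^ (1 - α))
        + 2 * (3 * A * b / H ^ 2 * Y ^ (1 - α)) := by
    field_simp; ring
  rw [hfin]
  linarith

/-! ### Partial sums and tails of the Dirichlet series over the primes -/

lemma mul_rpow_le_rpow_sub_rpow {t x : ℝ} (ht : 0 < t) (hx : 0 ≤ x) :
    x * (t + 1) ^ (-(1 + x)) ≤ t ^ (-x) - (t + 1) ^ (-x) := by
  have ht1 : 0 < t + 1 := by linarith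
  have h1 : 1 + x / (t + 1) ≤ (t / (t + 1)) ^ (-x) := by
    rw [Real.rpow_def_of_pos (by positivity)]
    have hl := Real.log_le_sub_one_of_pos (x := t / (t + 1)) (by positivity)
    have : t / (t + 1) - 1 = -(1 / (t + 1)) := by field_simp; ring
    rw [this] at hl
    have h2 : x / (t + 1) ≤ Real.log (t / (t + 1)) * -x := by
      have := mul_le_mul_of_nonneg_right hl hx
      have e : -(1 / (t + 1)) * x = -(x / (t + 1)) := by ring
      linarith
    linarith [Real.add_one_le_exp (Real.log (t / (t + 1)) * -x)]
  have h2 : t ^ (-x) = (t + 1) ^ (-x) * (t / (t + 1)) ^ (-x) := by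
    rw [← Real.mul_rpow ht1.le (by positivity)]; congr 1; field_simp
  have h3 : (t + 1) ^ (-(1 + x)) = (t + 1) ^ (-x) / (t + 1) := by
    rw [← Real.rpow_sub_one ht1.ne']; congr 1; ring
  rw [h2, h3]
  have := mul_le_mul_of_nonneg_left h1 (Real.rpow_nonneg ht1.le (-x))
  have e : (t + 1) ^ (-x) * (1 + x / (t + 1))
    = (t + 1) ^ (-x) + x * ((t + 1) ^ (-x) / (t + 1)) := by ring
  linarith

lemma hasSum_rpow_neg_telescope {x t : ℝ} (ht : 0 ≤ t) (hx : 0 < x) :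
    HasSum (fun k : ℕ => (t + k + 1) ^ (-x) - (t + (k + 1 : ℕ) + 1) ^ (-x)) ((t + 1) ^ (-x)) := by
  rw [hasSum_iff_tendsto_nat_of_nonneg]
  · have h : ∀ n : ℕ, ∑ k ∈ Finset.range n, ((t + k + 1) ^ (-x) - (t + (k + 1 : ℕ) + 1) ^ (-x))
        = (t + 1) ^ (-x) - (t + n + 1) ^ (-x) := by
      intro n
      rw [Finset.sum_range_sub' (fun k : ℕ => (t + k + 1) ^ (-x))]
      simp
    simp only [h]
    have h0 : Filter.Tendsto (fun n : ℕ => (t + n + 1) ^ (-x)) Filter.atTop (nhds 0) := by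
      refine (tendsto_rpow_neg_atTop hx).comp ?_
      refine Filter.tendsto_atTop_mono (fun n => ?_) tendsto_natCast_atTop_atTop
      linarith
    simpa using h0.const_sub ((t + 1) ^ (-x))
  · intro k
    rw [sub_nonneg]
    exact Real.rpow_le_rpow_of_nonpos (by positivity) (by push_cast; linarith) (by linarith)

/-- The tail of a series over the primes with terms `O(p^{-1-x})`. -/
lemma norm_sub_sum_primes_le {f : ℕ → ℂ} {a : ℂ} {C x : ℝ} {Y : ℕ} (hC : 0 ≤ C) (hY : 1 ≤ Y)
    (hx : 0 < x) (hf : ∀ p : ℕ, p.Prime → ‖f p‖ ≤ C * (p : ℝ) ^ (-(1 + x)))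
    (ha : HasSum (fun p : Nat.Primes => f p) a) :
    ‖a - ∑ p ∈ (Finset.range (Y + 1)).filter Nat.Prime, f p‖ ≤ C * (Y : ℝ) ^ (-x) / x := by
  have h1 : HasSum (Set.indicator {p : ℕ | p.Prime} f) a := hasSum_subtype_iff_indicator.mp ha
  have h2 := (hasSum_nat_add_iff' (Y + 1)).mpr h1
  have h3 : ∑ i ∈ Finset.range (Y + 1), Set.indicator {p : ℕ | p.Prime} f i
      = ∑ p ∈ (Finset.range (Y + 1)).filter Nat.Prime, f p := by
    rw [Finset.sum_filter]
    exact Finset.sum_congr rfl fun i _ => by simp [Set.indicator]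
  rw [h3] at h2
  rw [← h2.tsum_eq]
  obtain ⟨t, rfl⟩ : ∃ t, Y = t + 1 := ⟨Y - 1, by omega⟩
  have h4 := (hasSum_rpow_neg_telescope (t := t) (by positivity) hx).mul_left (C / x)
  refine (tsum_of_norm_bounded h4 fun k => ?_).trans_eq (by push_cast; ring)
  have h5 := mul_rpow_le_rpow_sub_rpow (t := (t : ℝ) + k + 1) (by positivity) hx.le
  have h6 : ‖Set.indicator {p : ℕ | p.Prime} f (k + (t + 1 + 1))‖
      ≤ C * ((t : ℝ) + k + 1 + 1) ^ (-(1 + x)) := by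
    by_cases hp : (k + (t + 1 + 1)).Prime
    · rw [Set.indicator_of_mem (by exact hp)]
      convert hf _ hp using 3
      push_cast; ring
    · rw [Set.indicator_of_notMem (by exact hp), norm_zero]
      positivity
  refine h6.trans ?_
  rw [div_mul_eq_mul_div, le_div_iff₀ hx]
  have e : (t : ℝ) + (k + 1 : ℕ) + 1 = t + k + 1 + 1 := by push_cast; ring
  rw [e]
  nlinarith

/-- For `u ≥ 1` the terms increase, and `u ≤ Y` is what absorbs the last one. -/
lemma sum_rpow_sub_one_le {u : ℝ} (hu : 0 < u) {Y : ℕ} (hY : 1 ≤ Y) (huY : u ≤ Y) :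
    ∑ n ∈ Finset.range Y, ((n : ℝ) + 1) ^ (u - 1) ≤ 2 * (Y : ℝ) ^ u / u := by
  rw [le_div_iff₀ hu, Finset.sum_mul]
  rcases le_total u 1 with h | h
  · have key : ∀ n : ℕ, ((n : ℝ) + 1) ^ (u - 1) * u ≤ ((n + 1 : ℕ) : ℝ) ^ u - (n : ℝ) ^ u := by
      intro n
      have hn : (0 : ℝ) < n + 1 := by positivity
      have h1 := rpow_one_add_le_one_add_mul_self (s := -(1 / ((n : ℝ) + 1)))
        (by rw [neg_le_neg_iff, div_le_one hn]; linarith [Nat.cast_nonneg (α := ℝ) n]) hu.le h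
      have h2 : (n : ℝ) = (n + 1) * (1 + -(1 / ((n : ℝ) + 1))) := by field_simp; ring
      have h0 : 0 ≤ 1 + -(1 / ((n : ℝ) + 1)) := by
        have : 1 / ((n : ℝ) + 1) ≤ 1 := by
          rw [div_le_one hn]; linarith [Nat.cast_nonneg (α := ℝ) n]
        linarith
      -- Bernoulli's inequality, for an exponent at most `1` here and at least `1` below.
      have h3 : (n : ℝ) ^ u ≤ ((n : ℝ) + 1) ^ u * (1 + u * -(1 / ((n : ℝ) + 1))) := by
        conv_lhs => rw [h2, Real.mul_rpow hn.le h0]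
        gcongr
      rw [Real.rpow_sub_one hn.ne']
      push_cast
      have e : ((n : ℝ) + 1) ^ u * (1 + u * -(1 / ((n : ℝ) + 1)))
        = ((n : ℝ) + 1) ^ u - ((n : ℝ) + 1) ^ u / (n + 1) * u := by ring
      linarith
    refine (Finset.sum_le_sum fun n _ => key n).trans ?_
    rw [Finset.sum_range_sub (fun n : ℕ => (n : ℝ) ^ u)]
    have : (0 : ℝ) ≤ (Y : ℝ) ^ u := by positivity
    simp only [Nat.cast_zero, Real.zero_rpow hu.ne', sub_zero]
    linarith
  · obtain ⟨t, rfl⟩ : ∃ t, Y = t + 1 := ⟨Y - 1, by omega⟩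
    have key : ∀ n : ℕ, ((n : ℝ) + 1) ^ (u - 1) * u
        ≤ (((n + 1 : ℕ) : ℝ) + 1) ^ u - ((n : ℝ) + 1) ^ u := by
      intro n
      have hn : (0 : ℝ) < n + 1 := by positivity
      have h1 := one_add_mul_self_le_rpow_one_add (s := 1 / ((n : ℝ) + 1))
        ((by norm_num : (-1 : ℝ) ≤ 0).trans (by positivity)) h
      have h2 : (n : ℝ) + 1 + 1 = (n + 1) * (1 + 1 / ((n : ℝ) + 1)) := by field_simp
      have h3 : ((n : ℝ) + 1) ^ u * (1 + u * (1 / ((n : ℝ) + 1))) ≤ ((n : ℝ) + 1 + 1) ^ u := by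
        rw [h2, Real.mul_rpow hn.le (by positivity)]
        gcongr
      rw [Real.rpow_sub_one hn.ne']
      push_cast
      have e : ((n : ℝ) + 1) ^ u * (1 + u * (1 / ((n : ℝ) + 1)))
        = ((n : ℝ) + 1) ^ u + ((n : ℝ) + 1) ^ u / (n + 1) * u := by ring
      linarith
    rw [Finset.sum_range_succ]
    have h1 := Finset.sum_le_sum fun n (_ : n ∈ Finset.range t) => key n
    rw [Finset.sum_range_sub (fun n : ℕ => ((n : ℝ) + 1) ^ u)] at h1
    have ht : (0 : ℝ) < t + 1 := by positivity
    have h2 : ((t : ℝ) + 1) ^ (u - 1) * u ≤ ((t : ℝ) + 1) ^ u := by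
      rw [Real.rpow_sub_one ht.ne', div_mul_eq_mul_div, div_le_iff₀ ht]
      push_cast at huY
      gcongr
    simp only [Nat.cast_zero, zero_add, Real.one_rpow] at h1
    push_cast
    linarith

/-- The partial sum over `p ≤ Y` of the Dirichlet series over the primes. -/
noncomputable def primePartialSum {m : ℕ} (c : ℕ → Fin m → ℂ) (Y : ℕ) (s : ℂ) : ℂ :=
  ∑ p ∈ (Finset.range (Y + 1)).filter Nat.Prime, dCoeff c p 1 * (p : ℂ) ^ (-s)

lemma primeSum_eq_primePartialSum {m : ℕ} (c : ℕ → Fin m → ℂ) (y α : ℝ) :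
    primeSum c y α = primePartialSum c ⌊y⌋₊ α := by
  simp only [primeSum, primePartialSum, div_eq_mul_inv, Complex.cpow_neg]

lemma differentiable_primePartialSum {m : ℕ} (c : ℕ → Fin m → ℂ) (Y : ℕ) :
    Differentiable ℂ (primePartialSum c Y) := by
  unfold primePartialSum
  refine Differentiable.fun_sum fun p hp s => ?_
  have : (p : ℂ) ≠ 0 := mod_cast (Finset.mem_filter.mp hp).2.ne_zero
  exact (differentiableAt_id.neg.const_cpow (Or.inl this)).const_mul _

section

variable {m : ℕ} {c : ℕ → Fin m → ℂ} (hc : ∀ p : ℕ, p.Prime → ∀ j, ‖c p j‖ ≤ 1)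
include hc

lemma norm_dCoeff_mul_cpow_le {p : ℕ} (hp : p.Prime) (s : ℂ) :
    ‖dCoeff c p 1 * (p : ℂ) ^ (-s)‖ ≤ m * (p : ℝ) ^ (-s.re) := by
  rw [dCoeff, Finset.sum_mul]
  refine (norm_sum_le_of_le (n := fun _ => (p : ℝ) ^ (-s.re)) _ fun j _ => ?_).trans_eq (by simp)
  rw [pow_one]
  exact norm_eulerRoot_le hc ⟨p, hp⟩ j s

lemma norm_primePartialSum_le {Y : ℕ} (hY : 1 ≤ Y) {s : ℂ} (hs : s.re < 1)
    (hsY : 1 - s.re ≤ Y) :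
    ‖primePartialSum c Y s‖ ≤ 2 * m * (Y : ℝ) ^ (1 - s.re) / (1 - s.re) := by
  have hu : 0 < 1 - s.re := by linarith
  have h1 : ‖primePartialSum c Y s‖
      ≤ ∑ p ∈ (Finset.range (Y + 1)).filter Nat.Prime, (m : ℝ) * (p : ℝ) ^ (-s.re) :=
    norm_sum_le_of_le _ fun p hp => norm_dCoeff_mul_cpow_le hc (Finset.mem_filter.mp hp).2 s
  refine h1.trans ?_
  rw [← Finset.mul_sum]
  have h2 : ∑ p ∈ (Finset.range (Y + 1)).filter Nat.Prime, (p : ℝ) ^ (-s.re)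
      ≤ ∑ n ∈ Finset.range Y, ((n : ℝ) + 1) ^ (1 - s.re - 1) := by
    have h3 : ∑ n ∈ Finset.range Y, ((n : ℝ) + 1) ^ (1 - s.re - 1)
        = ∑ n ∈ Finset.Ico 1 (Y + 1), (n : ℝ) ^ (-s.re) := by
      rw [Finset.sum_Ico_eq_sum_range]
      refine Finset.sum_congr rfl fun n _ => ?_
      push_cast
      congr 1 <;> ring
    rw [h3]
    refine Finset.sum_le_sum_of_subset_of_nonneg (fun p hp => ?_) fun _ _ _ => by positivity
    rw [Finset.mem_filter, Finset.mem_range] at hp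
    exact Finset.mem_Ico.mpr ⟨hp.2.pos, hp.1⟩
  calc _ ≤ (m : ℝ) * (2 * (Y : ℝ) ^ (1 - s.re) / (1 - s.re)) := by
        gcongr; exact h2.trans (sum_rpow_sub_one_le hu hY hsY)
    _ = _ := by ring

lemma norm_sub_primePartialSum_le {Y : ℕ} (hY : 1 ≤ Y) {s l : ℂ} (hs : 1 < s.re)
    (hl : HasSum (fun p : Nat.Primes => dCoeff c p 1 * ((p : ℕ) : ℂ) ^ (-s)) l) :
    ‖l - primePartialSum c Y s‖ ≤ m * (Y : ℝ) ^ (1 - s.re) / (s.re - 1) := by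
  have := norm_sub_sum_primes_le (f := fun p => dCoeff c p 1 * (p : ℂ) ^ (-s)) (C := m)
    (x := s.re - 1) (by positivity) hY (by linarith)
    (fun p hp => by simpa using norm_dCoeff_mul_cpow_le hc hp s) hl
  rwa [neg_sub] at this

end

/-! ### The size of the logarithm to the left of `Re s = 1` -/

lemma mem_zeroFreeRegion {δ : ℝ} {N : ℕ} {s : ℂ} (h1 : 1 - δ / 7 ≤ s.re)
    (h2 : |s.im| ≤ 2 * Real.log N ^ 3) : s ∈ zeroFreeRegion δ N := by
  rcases le_or_gt 1 s.re with h | h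
  · exact Or.inl h
  · exact Or.inr ⟨h1, h, h2⟩

lemma two_lt_log_of_sixteen_le {N : ℕ} (hN : 16 ≤ N) : 2.77 < Real.log N := by
  have h1 : Real.log 16 ≤ Real.log N :=
    Real.log_le_log (by norm_num) (by exact_mod_cast hN)
  have h2 : Real.log 16 = 4 * Real.log 2 := by
    rw [show (16 : ℝ) = 2 ^ (4 : ℕ) by norm_num, Real.log_pow]; norm_num
  linarith [Real.log_two_gt_d9]

/-- The upper bound for `Re log L = log |L|` that the growth hypothesis gives in the region. -/
lemma log_norm_le {z : ℂ} {K γ₁ γ₂ t : ℝ} {N : ℕ} (hK : 0 < K) (hγ₂ : 0 < γ₂)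
    (hN : 16 ≤ N) (hz : z ≠ 0) (ht : |t| ≤ 2 * Real.log N ^ 3)
    (h : ‖z‖ ≤ K * (N : ℝ) ^ γ₁ * (1 + |t|) ^ γ₂) :
    Real.log ‖z‖ ≤ (|Real.log K| + γ₁ + 6 * γ₂) * Real.log N := by
  have hl := two_lt_log_of_sixteen_le hN
  have hN0 : (0 : ℝ) < N := by positivity
  have ht0 : 0 < 1 + |t| := by positivity
  have h1 := Real.log_le_log (norm_pos_iff.mpr hz) h
  rw [Real.log_mul (by positivity) (by positivity), Real.log_mul hK.ne' (by positivity),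
    Real.log_rpow hN0, Real.log_rpow ht0] at h1
  have h2 : Real.log (1 + |t|) ≤ 6 * Real.log N := by
    rw [Real.log_le_iff_le_exp ht0]
    have h3 := Real.add_one_le_exp (2 * Real.log N)
    have h4 : Real.exp (6 * Real.log N) = Real.exp (2 * Real.log N) ^ 3 := by
      rw [← Real.exp_nat_mul]; congr 1; push_cast; ring
    rw [h4]
    calc 1 + |t| ≤ (2 * Real.log N + 1) ^ 3 := by nlinarith [sq_nonneg (Real.log N)]
      _ ≤ _ := by gcongr
  have h5 : Real.log K ≤ |Real.log K| * Real.log N :=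
    (le_abs_self _).trans (le_mul_of_one_le_right (abs_nonneg _) (by linarith))
  have h6 := mul_le_mul_of_nonneg_left h2 hγ₂.le
  linarith

/-- A bound `O(log N / δ)` for `log L(s) - C(s)` slightly to the right of the boundary of the
zero-free region, from the Borel–Carathéodory theorem on a disc centred at `2 + i Im s`. -/
theorem exists_norm_logL_sub_le (m : ℕ) {γ₁ γ₂ K : ℝ} (hγ₁ : 0 < γ₁) (hγ₂ : 0 < γ₂) (hK : 0 < K) :
    ∃ A : ℝ, 0 < A ∧ ∀ (c : ℕ → Fin m → ℂ) (L logL : ℂ → ℂ) (N : ℕ) (σL δ : ℝ),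
      HasEulerProduct c L → 16 ≤ N → 1 / 2 ≤ σL → 0 < δ → δ < 7 * (1 - σL) →
      (∀ s : ℂ, σL < s.re → s.re < 4 → ‖L s‖ ≤ K * (N : ℝ) ^ γ₁ * (1 + |s.im|) ^ γ₂) →
      IsLogOfL c L δ N logL →
      ∀ s : ℂ, 1 - δ / 8 ≤ s.re → s.re ≤ 1 → |s.im| ≤ Real.log N ^ 2 →
        ‖logL s - primePowerSeries c s‖ ≤ A * Real.log N / δ := by
  -- `E` bounds `log L` at the centre of the disc, and `F` bounds `C(s)`: as `δ < 7 / 2`, the real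
  -- part stays above `1 - δ / 8 > 9 / 16 > 1 / 2`.
  set E : ℝ := m * (3 / 2 * ∑' p : Nat.Primes, ((p : ℕ) : ℝ) ^ (-(2 : ℝ))) with hE
  set F : ℝ := m * (2 * ∑' p : Nat.Primes, ((p : ℕ) : ℝ) ^ (-(2 * (9 / 16 : ℝ)))) with hF
  have hE0 : 0 ≤ E := by
    have : 0 ≤ ∑' p : Nat.Primes, ((p : ℕ) : ℝ) ^ (-(2 : ℝ)) := tsum_nonneg fun p => by positivity
    positivity
  have hF0 : 0 ≤ F := by
    have : 0 ≤ ∑' p : Nat.Primes, ((p : ℕ) : ℝ) ^ (-(2 * (9 / 16 : ℝ))) :=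
      tsum_nonneg fun p => by positivity
    positivity
  set G : ℝ := |Real.log K| + γ₁ + 6 * γ₂ with hG
  have hG0 : 0 < G := by positivity
  refine ⟨168 * G + 168 * E + 4 * F, by positivity, ?_⟩
  intro c L logL N σL δ hL hN hσ hδ hδσ hgrow hlog s hs1 hs2 hs3
  have hl := two_lt_log_of_sixteen_le hN
  set l := Real.log N with hl_def
  have hδ2 : δ < 7 / 2 := by linarith
  set z₀ : ℂ := 2 + s.im * I with hz₀
  have hre : ∀ z : ℂ, (z₀ + z).re = 2 + z.re := fun z => by simp [hz₀]
  have him : ∀ z : ℂ, (z₀ + z).im = s.im + z.im := fun z => by simp [hz₀]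
  have hball : ∀ z ∈ Metric.ball (0 : ℂ) (1 + δ / 7), 1 - δ / 7 < (z₀ + z).re ∧
      (z₀ + z).re < 4 ∧ |(z₀ + z).im| ≤ 2 * l ^ 3 := by
    intro z hz
    rw [mem_ball_zero_iff] at hz
    have h1 := abs_le.mp ((Complex.abs_re_le_norm z).trans hz.le)
    have h1' := (abs_lt.mp ((Complex.abs_re_le_norm z).trans_lt hz))
    have h2 := (Complex.abs_im_le_norm z).trans hz.le
    rw [hre, him]
    refine ⟨by linarith [h1'.1], by linarith [h1.2], ?_⟩
    have h3 := abs_add_le s.im z.im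
    nlinarith [sq_nonneg l]
  have hmem : ∀ z ∈ Metric.ball (0 : ℂ) (1 + δ / 7), z₀ + z ∈ zeroFreeRegion δ N := fun z hz =>
    mem_zeroFreeRegion (hball z hz).1.le (hball z hz).2.2
  have hd : DifferentiableOn ℂ (fun z => logL (z₀ + z)) (Metric.ball 0 (1 + δ / 7)) := by
    intro z hz
    have h1 := (hlog.holomorphic _ (hmem z hz)).differentiableAt
    exact (h1.comp z (by fun_prop : DifferentiableAt ℂ (fun z => z₀ + z) z)).differentiableWithinAt
  have hmaps : Set.MapsTo (fun z => logL (z₀ + z)) (Metric.ball 0 (1 + δ / 7))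
      {z | z.re ≤ G * l} := by
    intro z hz
    have h1 := hball z hz
    have h2 := hlog.exp_eq _ (hmem z hz)
    have h3 : Real.log ‖L (z₀ + z)‖ = (logL (z₀ + z)).re := by
      rw [← h2, Complex.norm_exp, Real.log_exp]
    change (logL (z₀ + z)).re ≤ G * l
    rw [← h3]
    exact log_norm_le hK hγ₂ hN (h2 ▸ Complex.exp_ne_zero _) h1.2.2
      (hgrow _ (by linarith [h1.1]) h1.2.1)
  have hw : ‖s - z₀‖ = 2 - s.re := by
    have : s - z₀ = ((s.re - 2 : ℝ) : ℂ) := by apply Complex.ext <;> simp [hz₀]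
    rw [this, Complex.norm_real, Real.norm_eq_abs, abs_of_nonpos (by linarith)]
    ring
  have hBC := Complex.borelCaratheodory (mul_pos hG0 (by linarith)) hd hmaps (by linarith)
    (z := s - z₀) (by rw [mem_ball_zero_iff, hw]; linarith)
  simp only [add_sub_cancel, add_zero, hw] at hBC
  have hcenter : ‖logL z₀‖ ≤ E := by
    have h2 : z₀.re = 2 := by simp [hz₀]
    have h1 : logL z₀ = eulerLog c z₀ :=
      (hlog.eulerSeries z₀ (by rw [h2]; norm_num)).unique
        (hasSum_eulerLog hL.1 (by rw [h2]; norm_num))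
    rw [h1]
    exact norm_eulerLog_le hL.1 (by norm_num) h2.ge
  have hden : δ / 56 ≤ 1 + δ / 7 - (2 - s.re) := by linarith
  have hδ56 : 0 < δ / 56 := by positivity
  have hr : 0 ≤ 2 - s.re := by linarith
  have hlogL : ‖logL s‖ ≤ (168 * G + 168 * E) * l / δ := by
    calc ‖logL s‖ ≤ _ := hBC
      _ ≤ 2 * (G * l) * (3 / 2) / (δ / 56) + E * 3 / (δ / 56) := by
          gcongr <;> linarith
      _ = (168 * (G * l) + 168 * E) / δ := by field_simp; ring
      _ ≤ _ := by gcongr; nlinarith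
  have hC : ‖primePowerSeries c s‖ ≤ F :=
    norm_primePowerSeries_le hL.1 (a := 9 / 16) (by norm_num) (by linarith)
  have hF' : F ≤ 4 * F * l / δ := by
    rw [le_div_iff₀ hδ]
    nlinarith [mul_nonneg hF0 hδ.le]
  calc ‖logL s - primePowerSeries c s‖ ≤ ‖logL s‖ + ‖primePowerSeries c s‖ := norm_sub_le _ _
    _ ≤ (168 * G + 168 * E) * l / δ + 4 * F * l / δ := by linarith
    _ = _ := by ring

/-! ### The asymptotic formula -/

lemma natFloor_rpow_le {y e : ℝ} (hy : 1 ≤ y) (he : -2 ≤ e) : (⌊y⌋₊ : ℝ) ^ e ≤ 4 * y ^ e := by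
  have hY : (1 : ℝ) ≤ ⌊y⌋₊ := by exact_mod_cast Nat.le_floor (a := y) (n := 1) (by simpa using hy)
  have hY2 : (⌊y⌋₊ : ℝ) ≤ y := Nat.floor_le (by linarith)
  have hy0 : 0 ≤ y ^ e := Real.rpow_nonneg (by linarith) _
  rcases le_total 0 e with h | h
  · have := Real.rpow_le_rpow (by linarith) hY2 h
    linarith
  · have hlt := Nat.lt_floor_add_one y
    have h1 : (⌊y⌋₊ : ℝ) ^ e ≤ (y / 2) ^ e :=
      Real.rpow_le_rpow_of_nonpos (by linarith) (by linarith) h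
    have h2 : (y / 2) ^ e = y ^ e * 2 ^ (-e) := by
      rw [Real.div_rpow (by linarith) (by norm_num), Real.rpow_neg (by norm_num)]; rfl
    have h3 : (2 : ℝ) ^ (-e) ≤ 2 ^ (2 : ℝ) :=
      Real.rpow_le_rpow_of_exponent_le (by norm_num) (by linarith)
    have h4 : (2 : ℝ) ^ (2 : ℝ) = 4 := by norm_num
    rw [h4] at h3
    rw [h2] at h1
    nlinarith

lemma log_one_add_sq_div_le {l δ d : ℝ} (hl : 1 ≤ l) (hδ : 0 < δ) (hδ2 : δ < 7 / 2)
    (hd : δ / 12 ≤ d) : Real.log (1 + l ^ 2 / d) ≤ 40 * l ^ (1 / 4 : ℝ) / δ := by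
  have hd0 : 0 < d := lt_of_lt_of_le (by positivity) hd
  have hl0 : 0 < l := by linarith
  have h1 : 1 + l ^ 2 / d ≤ l ^ 2 * (1 + 12 / δ) := by
    have h2 : l ^ 2 / d ≤ l ^ 2 / (δ / 12) := by gcongr
    have h3 : l ^ 2 / (δ / 12) = l ^ 2 * (12 / δ) := by field_simp
    nlinarith
  have h2 : Real.log (1 + l ^ 2 / d) ≤ 2 * Real.log l + 12 / δ := by
    refine (Real.log_le_log (by positivity) h1).trans ?_
    rw [Real.log_mul (by positivity) (by positivity), Real.log_pow]
    have := Real.log_le_sub_one_of_pos (x := 1 + 12 / δ) (by positivity)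
    push_cast
    linarith
  have h3 := Real.log_le_rpow_div hl0.le (ε := 1 / 4) (by norm_num)
  have h4 : 1 ≤ l ^ (1 / 4 : ℝ) := Real.one_le_rpow hl (by norm_num)
  rw [le_div_iff₀ hδ]
  have h5 : 12 / δ * δ = 12 := by field_simp
  have h6 := mul_le_mul_of_nonneg_right h2 hδ.le
  nlinarith

lemma four_le_fourteen_div {δ : ℝ} (hδ : 0 < δ) (hδ2 : δ < 7 / 2) : 4 ≤ 14 / δ := by
  rw [le_div_iff₀ hδ]; linarith

lemma sq_add_one_le_rpow {l δ : ℝ} (hl : 2 ≤ l) (hδ : 0 < δ) (hδ2 : δ < 7 / 2) :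
    l ^ 2 + 1 ≤ l ^ (14 / δ) := by
  have h : l ^ 4 ≤ l ^ (14 / δ) := by
    rw [← Real.rpow_natCast l 4]
    exact Real.rpow_le_rpow_of_exponent_le (by linarith)
      (by push_cast; exact four_le_fourteen_div hδ hδ2)
  have h2 : 4 ≤ l ^ 2 := by nlinarith
  nlinarith

/-- The contribution of the left side of the contour, which lies on `Re s = 1 - δ/8`. Having
moved past `1 - δ/14` gains `y^{-3δ/56}`; half of it absorbs the logarithmic length of the
contour, since `y^δ ≥ (log N)^{14}`, the other half yields the factor `1 / (δ log y)`. -/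
lemma rpow_mul_log_le {l δ y e d : ℝ} (hl : 1 < l) (hδ : 0 < δ) (hδ2 : δ < 7 / 2)
    (hd : δ / 12 ≤ d) (hy : l ^ (14 / δ) ≤ y) :
    y ^ (e - δ / 8) * Real.log (1 + l ^ 2 / d) ≤
      4480 / 3 * (y ^ (e - δ / 14) / (δ ^ 2 * Real.log y)) := by
  have hl0 : 0 < l := by linarith
  have hy1 : 1 < y := lt_of_lt_of_le (Real.one_lt_rpow hl (by positivity)) hy
  have hy0 : 0 < y := by linarith
  have hlogy : 0 < Real.log y := Real.log_pos hy1
  set q := y ^ (3 * δ / 112) with hq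
  have hq0 : 0 < q := Real.rpow_pos_of_pos hy0 _
  have h1 : l ^ (1 / 4 : ℝ) ≤ q := by
    calc l ^ (1 / 4 : ℝ) ≤ l ^ (14 / δ * (3 * δ / 112)) := by
          refine Real.rpow_le_rpow_of_exponent_le hl.le ?_
          have : 14 / δ * (3 * δ / 112) = 3 / 8 := by field_simp; norm_num
          rw [this]; norm_num
      _ = (l ^ (14 / δ)) ^ (3 * δ / 112) := Real.rpow_mul hl0.le _ _
      _ ≤ q := by rw [hq]; gcongr
  have h2 : 3 * δ / 112 * Real.log y ≤ q := by
    have := Real.log_le_rpow_div hy0.le (ε := 3 * δ / 112) (by positivity)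
    rw [le_div_iff₀ (by positivity)] at this
    linarith
  have h3 := log_one_add_sq_div_le hl.le hδ hδ2 hd
  have h4 : y ^ (e - δ / 14) = y ^ (e - δ / 8) * (q * q) := by
    rw [hq, ← Real.rpow_add hy0, ← Real.rpow_add hy0]; congr 1; ring
  rw [h4]
  have hz : 0 < y ^ (e - δ / 8) := Real.rpow_pos_of_pos hy0 _
  have h5 : Real.log (1 + l ^ 2 / d) ≤ 4480 / 3 * (q * q / (δ ^ 2 * Real.log y)) := by
    refine h3.trans ?_
    rw [← mul_div_assoc, div_le_div_iff₀ hδ (by positivity)]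
    have h6 : l ^ (1 / 4 : ℝ) * (3 * δ / 112 * Real.log y) ≤ q * q := by gcongr
    nlinarith
  calc _ ≤ y ^ (e - δ / 8) * (4480 / 3 * (q * q / (δ ^ 2 * Real.log y))) := by gcongr
    _ = _ := by ring

lemma errorTermOne_eq {δ y : ℝ} {N : ℕ} (hy : 0 < y) : errorTermOne δ N y = errorTerm δ N y 1 := by
  have h : y ^ (1 - δ / 14 - 1) = (y ^ (δ / 14))⁻¹ := by
    rw [← Real.rpow_neg hy.le]; congr 1; ring
  have h2 : (2 - 1 : ℝ) = 1 := by norm_num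
  rw [errorTermOne, errorTerm, h, sub_self, Real.rpow_zero, h2, one_pow, one_mul]
  congr 1
  rw [inv_mul_eq_div, div_div]
  congr 1
  ring

/-- The first and the last summand of the error term already dominate the contour estimate. -/
lemma mul_add_mul_le_errorTerm {δ y α U V : ℝ} {N : ℕ} (hN : 16 ≤ N) (hδ : 0 < δ)
    (hy : 1 < y) (hyN : y ≤ (N : ℝ) ^ (2 * Real.pi / 5)) (hα : 1 / 2 ≤ α) (hα2 : α < 2)
    (hU : 0 ≤ U) (hV : 0 ≤ V) :
    U * (y ^ (1 - α) / Real.log N) + V * (y ^ (1 - α - δ / 14) * Real.log N / (δ ^ 3 * Real.log y))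
      ≤ (5 * U + V) * errorTerm δ N y α := by
  have hl := two_lt_log_of_sixteen_le hN
  have hl0 : 0 < Real.log N := by linarith
  have hll : 0 < Real.log (Real.log N) := Real.log_pos (by linarith)
  have hN0 : (0 : ℝ) < N := by positivity
  have hy0 : 0 < y := by linarith
  have hlogy : 0 < Real.log y := Real.log_pos hy
  have hlogy2 : Real.log y ≤ 2 * Real.log N := by
    have := Real.log_le_log hy0 hyN
    rw [Real.log_rpow hN0] at this
    nlinarith [Real.pi_lt_four]
  have h2α : 0 < 2 - α := by linarith
  set T₁ := y ^ (1 - α) / ((2 - α) ^ 2 * Real.log y) with hT₁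
  set T₄ := y ^ (1 - δ / 14 - α) * Real.log N / (δ ^ 3 * Real.log y) with hT₄
  have h1 : y ^ (1 - α) / Real.log N ≤ 5 * T₁ := by
    rw [hT₁, ← mul_div_assoc, div_le_div_iff₀ hl0 (by positivity)]
    have hp : 0 < y ^ (1 - α) := Real.rpow_pos_of_pos hy0 _
    have : (2 - α) ^ 2 * Real.log y ≤ 5 * Real.log N := by
      have h3 : (2 - α) ^ 2 ≤ 9 / 4 := by nlinarith
      calc _ ≤ 9 / 4 * (2 * Real.log N) := by gcongr
        _ ≤ _ := by linarith
    nlinarith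
  have hT₁0 : 0 ≤ T₁ := by positivity
  have hT₄0 : 0 ≤ T₄ := by positivity
  have hle : T₁ + T₄ ≤ errorTerm δ N y α := by
    rw [errorTerm, ← hT₁, ← hT₄]
    have h2 : 0 ≤ Real.log N ^ 2 / (Real.log (Real.log N) * Real.log N ^ (14 / δ)) := by positivity
    have h3 : 0 ≤ y ^ (1 + δ / 14) * Real.log N ^ (δ / 14 + 3 / 2)
        / (δ ^ 2 * (N : ℝ) ^ (Real.pi / 2)) := by positivity
    linarith
  rw [sub_right_comm 1 α]
  calc _ ≤ U * (5 * T₁) + V * T₄ := by gcongr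
    _ ≤ (5 * U + V) * (T₁ + T₄) := by nlinarith [mul_nonneg hU hT₄0, mul_nonneg hV hT₁0]
    _ ≤ _ := by gcongr

theorem exists_norm_logL_sub_le_errorTerm (m : ℕ) {γ₁ γ₂ K : ℝ} (hγ₁ : 0 < γ₁) (hγ₂ : 0 < γ₂)
    (hK : 0 < K) :
    ∃ M : ℝ, 0 < M ∧ ∀ (c : ℕ → Fin m → ℂ) (L logL : ℂ → ℂ) (N : ℕ) (σL δ : ℝ),
      HasEulerProduct c L → 16 ≤ N → 1 / 2 ≤ σL → 0 < δ → δ < 7 * (1 - σL) →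
      (∀ s : ℂ, σL < s.re → s.re < 4 → ‖L s‖ ≤ K * (N : ℝ) ^ γ₁ * (1 + |s.im|) ^ γ₂) →
      IsLogOfL c L δ N logL →
      ∀ y α : ℝ, (Real.log N) ^ (14 / δ) ≤ y → y ≤ (N : ℝ) ^ (2 * Real.pi / 5) →
        1 - δ / 28 < α → α < 2 - δ / 7 →
        ‖logL (α : ℂ) - (primeSum c y α + CConst c α)‖ ≤ M * errorTerm δ N y α := by
  obtain ⟨A, hA, hbound⟩ := exists_norm_logL_sub_le m hγ₁ hγ₂ hK
  refine ⟨5 * (4 * (72 * m + A)) + 71680 * A, by positivity, ?_⟩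
  intro c L logL N σL δ hL hN hσ hδ hδσ hgrow hlog y α hy hyN hα1 hα2
  have hl := two_lt_log_of_sixteen_le hN
  have hb := hbound c L logL N σL δ hL hN hσ hδ hδσ hgrow hlog
  set l := Real.log N with hl_def
  have hδ2 : δ < 7 / 2 := by linarith
  have hll : l ^ 2 + 1 ≤ y := (sq_add_one_le_rpow (by linarith) hδ hδ2).trans hy
  have hy1 : 1 < y := by nlinarith [sq_nonneg l]
  have hY1 : 1 ≤ ⌊y⌋₊ := Nat.le_floor (by simpa using hy1.le)
  have hYl : l ^ 2 ≤ ⌊y⌋₊ := by linarith [Nat.lt_floor_add_one y]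
  have hmem : ∀ s : ℂ, 1 - δ / 8 ≤ s.re → |s.im| ≤ l ^ 2 → s ∈ zeroFreeRegion δ N := by
    intro s h1 h2
    exact mem_zeroFreeRegion (by linarith) (by rw [← hl_def]; nlinarith [sq_nonneg l])
  have key := norm_sub_le_of_contour (P := fun s => logL s - primePowerSeries c s)
    (S := primePartialSum c ⌊y⌋₊) (A := A * l / δ) (B := 2 * m) (Y := ⌊y⌋₊) (H := l ^ 2) (α := α)
    (b := δ / 8) (by exact_mod_cast hY1) (by nlinarith) (by positivity) (by positivity)
    (by positivity) (by linarith) (by linarith) (by linarith)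
    (fun s h1 _ h3 => (hlog.holomorphic s (hmem s h1 h3)).differentiableAt.sub
      (differentiableAt_primePowerSeries hL.1 (by linarith)))
    (differentiable_primePartialSum c _)
    (fun s hs => by
      refine (norm_sub_primePartialSum_le hL.1 hY1 hs
        (hasSum_primes_of_hasSum_eulerLog hL.1 hs (hlog.eulerSeries s hs))).trans ?_
      have : 0 < s.re - 1 := by linarith
      gcongr
      linarith [Nat.cast_nonneg (α := ℝ) m])
    (fun s hs hs' => norm_primePartialSum_le hL.1 hY1 hs (by linarith))
    (fun s h1 h2 h3 => hb s h1 h2 h3)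
  have heq : logL (α : ℂ) - (primeSum c y α + CConst c α)
      = logL α - primePowerSeries c α - primePartialSum c ⌊y⌋₊ α := by
    rw [primeSum_eq_primePartialSum, CConst_eq_primePowerSeries hL.1 (by linarith)]; ring
  rw [heq]
  refine key.trans (le_trans (add_le_add ?_ ?_) (mul_add_mul_le_errorTerm hN hδ hy1 hyN
    (by linarith) (by linarith) (by positivity) (by positivity)))
  · have h1 := natFloor_rpow_le hy1.le (e := 1 - α) (by linarith)
    have h2 : (36 * (2 * (m : ℝ)) + 6 * (A * l / δ) * (δ / 8) / l ^ 2) / l ^ 2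
        ≤ (72 * m + A) / l := by
      have e : 6 * (A * l / δ) * (δ / 8) / l ^ 2 = 3 / 4 * A / l := by field_simp; norm_num
      rw [e]
      have h3 : 3 / 4 * A / l ≤ A := by rw [div_le_iff₀ (by linarith)]; nlinarith
      have h4 : l ≤ l ^ 2 := by nlinarith
      gcongr ?_ / ?_
      linarith
    calc _ ≤ (72 * m + A) / l * (4 * y ^ (1 - α)) := by gcongr
      _ = _ := by ring
  · have h1 := natFloor_rpow_le hy1.le (e := 1 - α - δ / 8) (by linarith)
    have h2 := rpow_mul_log_le (e := 1 - α) (d := α - (1 - δ / 8)) (by linarith : 1 < l) hδ hδ2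
      (by linarith) hy
    have hd : 0 < α - (1 - δ / 8) := by linarith
    have hlog0 : 0 ≤ Real.log (1 + l ^ 2 / (α - (1 - δ / 8))) :=
      Real.log_nonneg (by linarith [show 0 ≤ l ^ 2 / (α - (1 - δ / 8)) by positivity])
    rw [sub_right_comm 1 (δ / 8)]
    calc _ ≤ 12 * (A * l / δ) * (4 * y ^ (1 - α - δ / 8))
          * Real.log (1 + l ^ 2 / (α - (1 - δ / 8))) := by gcongr
      _ = 48 * (A * l / δ) * (y ^ (1 - α - δ / 8)
          * Real.log (1 + l ^ 2 / (α - (1 - δ / 8)))) := by ring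
      _ ≤ 48 * (A * l / δ) * (4480 / 3 * (y ^ (1 - α - δ / 14) / (δ ^ 2 * Real.log y))) := by gcongr
      _ = _ := by rw [hl_def]; field_simp; ring

/-! ### The error term at `α = 1` for fixed `δ` -/

lemma errorTermOne_nonneg {δ y : ℝ} {N : ℕ} (hN : 16 ≤ N) (hδ : 0 < δ) (hy : 1 ≤ y) :
    0 ≤ errorTermOne δ N y := by
  have hl := two_lt_log_of_sixteen_le hN
  have hll : 0 < Real.log (Real.log N) := Real.log_pos (by linarith)
  have := Real.log_nonneg hy
  unfold errorTermOne
  positivity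

/-- A bound independent of `y`: the range of `y` gives `y ^ (δ / 14) ≥ log N` and
`y ^ (1 + δ / 14) ≤ N ^ ((2 π / 5) (1 + δ / 14))`. -/
lemma errorTermOne_le {δ y : ℝ} {N : ℕ} (hN : 16 ≤ N) (hδ : 0 < δ) (hδ2 : δ < 7 / 2)
    (hy : (Real.log N) ^ (14 / δ) ≤ y) (hyN : y ≤ (N : ℝ) ^ (2 * Real.pi / 5)) :
    errorTermOne δ N y ≤ (2 + 1 / δ ^ 3) / Real.log (Real.log N)
      + (Real.log N) ^ (δ / 14 + 3 / 2)
        / (N : ℝ) ^ (Real.pi / 2 - 2 * Real.pi / 5 * (1 + δ / 14)) / δ ^ 2 := by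
  have hl := two_lt_log_of_sixteen_le hN
  have hN0 : (0 : ℝ) < N := by positivity
  set l := Real.log N with hl_def
  have hll : 0 < Real.log l := Real.log_pos (by linarith)
  have hl0 : 0 < l := by linarith
  have hl4 := sq_add_one_le_rpow (l := l) (by linarith) hδ hδ2
  have hly : l ≤ y := by nlinarith
  have hy0 : 0 < y := by linarith
  have hlogy : Real.log l ≤ Real.log y := Real.log_le_log (by linarith) hly
  have hlogy0 : 0 < Real.log y := by linarith
  have h1 : 1 / Real.log y ≤ 1 / Real.log l := by gcongr
  have h2 : l ^ 2 / (Real.log l * l ^ (14 / δ)) ≤ 1 / Real.log l := by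
    rw [div_le_div_iff₀ (by positivity) hll]
    have : l ^ 2 ≤ l ^ (14 / δ) := by linarith
    nlinarith
  have h4 : l / (δ ^ 3 * y ^ (δ / 14) * Real.log y) ≤ 1 / δ ^ 3 / Real.log l := by
    have h5 : l ≤ y ^ (δ / 14) := by
      calc l = (l ^ (14 / δ)) ^ (δ / 14) := by
            rw [← Real.rpow_mul (by linarith)]
            have : 14 / δ * (δ / 14) = 1 := by field_simp
            rw [this, Real.rpow_one]
        _ ≤ _ := by gcongr
    rw [div_div, div_le_div_iff₀ (by positivity) (by positivity), one_mul]
    calc l * (δ ^ 3 * Real.log l) ≤ y ^ (δ / 14) * (δ ^ 3 * Real.log y) := by gcongr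
      _ = _ := by ring
  have h3 : y ^ (1 + δ / 14) * l ^ (δ / 14 + 3 / 2) / (δ ^ 2 * (N : ℝ) ^ (Real.pi / 2))
      ≤ l ^ (δ / 14 + 3 / 2)
        / (N : ℝ) ^ (Real.pi / 2 - 2 * Real.pi / 5 * (1 + δ / 14)) / δ ^ 2 := by
    have h5 : y ^ (1 + δ / 14) ≤ (N : ℝ) ^ (2 * Real.pi / 5 * (1 + δ / 14)) := by
      rw [Real.rpow_mul hN0.le]; gcongr
    calc _ ≤ (N : ℝ) ^ (2 * Real.pi / 5 * (1 + δ / 14)) * l ^ (δ / 14 + 3 / 2)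
          / (δ ^ 2 * (N : ℝ) ^ (Real.pi / 2)) := by gcongr
      _ = _ := by rw [Real.rpow_sub hN0]; field_simp
  rw [errorTermOne, ← hl_def]
  have e : (2 + 1 / δ ^ 3) / Real.log l
      = 1 / Real.log l + 1 / Real.log l + 1 / δ ^ 3 / Real.log l := by ring
  linarith

theorem exists_errorTermOne_le {δ ε : ℝ} (hδ : 0 < δ) (hδ2 : δ < 7 / 2) (hε : 0 < ε) :
    ∃ N₀ : ℕ, ∀ N : ℕ, 16 ≤ N → N₀ ≤ N → ∀ y : ℝ, (Real.log N) ^ (14 / δ) ≤ y →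
      y ≤ (N : ℝ) ^ (2 * Real.pi / 5) → |errorTermOne δ N y| ≤ ε := by
  -- This exponent is positive exactly because `δ < 7 / 2`.
  have hη : 0 < Real.pi / 2 - 2 * Real.pi / 5 * (1 + δ / 14) := by nlinarith [Real.pi_pos]
  have t1 : Filter.Tendsto (fun x : ℝ => (2 + 1 / δ ^ 3) / Real.log (Real.log x))
      Filter.atTop (nhds 0) :=
    (Real.tendsto_log_atTop.comp Real.tendsto_log_atTop).const_div_atTop _
  have t2 := ((isLittleO_log_rpow_rpow_atTop (δ / 14 + 3 / 2) hη).tendsto_div_nhds_zero).div_const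
    (δ ^ 2)
  have t3 := (t1.add t2).comp (tendsto_natCast_atTop_atTop (R := ℝ))
  rw [zero_div, add_zero] at t3
  obtain ⟨N₀, hN₀⟩ := Filter.eventually_atTop.mp (t3.eventually_le_const hε)
  refine ⟨N₀, fun N hN hNN y hy hyN => ?_⟩
  have hl := two_lt_log_of_sixteen_le hN
  have hy1 : 1 ≤ y := (Real.one_le_rpow (by linarith) (by positivity)).trans hy
  rw [abs_of_nonneg (errorTermOne_nonneg hN hδ hy1)]
  exact (errorTermOne_le hN hδ hδ2 hy hyN).trans (hN₀ N hNN)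

theorem theorem3 :
    -- the asymptotic formulas; the implied constant `M` depends only on `m`, `γ₁`, `γ₂` and on
    -- the implied constant `K` of the growth assumption
    (∀ (m : ℕ) (γ₁ γ₂ K : ℝ), 1 ≤ m → 0 < γ₁ → 0 < γ₂ → 0 < K →
      ∃ M : ℝ, 0 < M ∧
        ∀ (c : ℕ → Fin m → ℂ) (L : ℂ → ℂ) (N : ℕ) (σL δ : ℝ),
          HasEulerProduct c L →
          16 ≤ N →
          1 / 2 ≤ σL → σL < 1 →
          AnalyticOnNhd ℂ L {s : ℂ | σL ≤ s.re} →
          0 < δ → δ < 7 * (1 - σL) →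
          (∀ s ∈ zeroFreeRegion δ N, L s ≠ 0) →
          (∀ s : ℂ, σL < s.re → s.re < 4 →
            ‖L s‖ ≤ K * (N : ℝ) ^ γ₁ * (1 + |s.im|) ^ γ₂) →
          (∃ logL : ℂ → ℂ, IsLogOfL c L δ N logL) ∧
          ∀ logL : ℂ → ℂ, IsLogOfL c L δ N logL →
            ∀ y : ℝ, (Real.log N) ^ (14 / δ) ≤ y → y ≤ (N : ℝ) ^ (2 * Real.pi / 5) →
              (∀ α : ℝ, 1 - δ / 28 < α → α < 2 - δ / 7 →
                ‖logL (α : ℂ) - (primeSum c y α + CConst c α)‖ ≤ M * errorTerm δ N y α) ∧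
              ‖logL 1 - (primeSum c y 1 + CConst c 1)‖ ≤ M * errorTermOne δ N y) ∧
    -- for fixed `δ` the error term at `α = 1` is `o(1)` as `N → ∞`, uniformly in `y`
    (∀ δ : ℝ, 0 < δ → δ < 7 / 2 → ∀ ε : ℝ, 0 < ε → ∃ N₀ : ℕ, ∀ N : ℕ, 16 ≤ N → N₀ ≤ N →
      ∀ y : ℝ, (Real.log N) ^ (14 / δ) ≤ y → y ≤ (N : ℝ) ^ (2 * Real.pi / 5) →
        |errorTermOne δ N y| ≤ ε) := by
  refine ⟨fun m γ₁ γ₂ K _ hγ₁ hγ₂ hK => ?_,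
    fun δ hδ hδ2 ε hε => exists_errorTermOne_le hδ hδ2 hε⟩
  obtain ⟨M, hM, h⟩ := exists_norm_logL_sub_le_errorTerm m hγ₁ hγ₂ hK
  refine ⟨M, hM, fun c L N σL δ hL hN hσ hσ1 hLA hδ hδσ h0 hgrow => ⟨?_, ?_⟩⟩
  · refine exists_isLogOfL hL hδ.le (hLA.mono fun s hs => ?_) h0
    rcases hs with hs | hs
    · exact hσ1.le.trans hs
    · have h1 := hs.1
      change σL ≤ s.re
      linarith
  · intro logL hlog y hy hyN
    have key := fun α => h c L logL N σL δ hL hN hσ hδ hδσ hgrow hlog y α hy hyN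
    refine ⟨key, ?_⟩
    have hl := two_lt_log_of_sixteen_le hN
    have hy0 : 0 < y := lt_of_lt_of_le (Real.rpow_pos_of_pos (by linarith) _) hy
    rw [errorTermOne_eq hy0]
    simpa using key 1 (by linarith) (by linarith)
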